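/- Let $d\in\mathbb N$, $\mathcal I=\{1,\dots,d\}$, $\alpha_i>0$ and $c_i\in\mathbb R$ for $i\in\mathcal I$. Let $(\mathbf Z,\mathbf Z^*)=(Z_1,\dots,Z_d,Z_1^*,\dots,Z_d^*)$ be jointly Gaussian with zero means and unit variances (the covariance matrix may be singular), and let $\mathbf Z$ and $\mathbf Z^*$ be independent. Let $V_0$ be a unit exponential variable independent of $(\mathbf Z,\mathbf Z^*)$, and put $$X_i=Z_i+\frac1{\alpha_i}\,V_0\,\mathbf 1(Z_i^*>c_i),\qquad i\in\mathcal I .$$ The stable tail dependence function of a random vector with continuous margins and copula $C$ is $\ell(\mathbf x)=\lim_{n\to\infty}n\{1-C(1-x_1/n,\dots,1-x_d/n)\}$, $\mathbf x\in[0,\infty)^d$, provided that the limit exists for every such $\mathbf x$. For $\mathcal A\subset\mathcal I$ and $i,j\in\mathcal A$ let $\lambda_{ij}=\tfrac12(\alpha_i^2-2\rho_{ij}\alpha_i\alpha_j+\alpha_j^2)^{1/2}$ with $\rho_{ij}=\mathrm{Cor}(Z_i,Z_j)$, and let $$\ell_{\mathcal A}(\mathbf x)=\sum_{j\in\mathcal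 A}x_j\,\Phi_{|\mathcal A|-1}\Big[\Big\{\lambda_{ij}+\frac{\log(x_j/x_i)}{2\lambda_{ij}}\Big\}_{i\in\mathcal A\setminus\{j\}};\bar\Sigma^{(j)}\Big],\qquad \mathbf x\in[0,\infty)^{\mathcal A},$$ be the Hüsler–Reiss stable tail dependence function with parameters $(\lambda_{ij})$. Here $\Phi_k(\cdot;\Sigma)$ is the distribution function of the $k$-dimensional centred normal distribution with covariance matrix $\Sigma$, and $\bar\Sigma^{(j)}$ has unit diagonal and off-diagonal entries $(\lambda_{kj}^2+\lambda_{ij}^2-\lambda_{ki}^2)/(2\lambda_{kj}\lambda_{ij})$, read as $0$ if $\lambda_{kj}\lambda_{ij}=0$. The $i$-th argument of $\Phi_{|\mathcal A|-1}$ is read as $+\infty$ if $x_i=0$; if $x_i>0$ and $\lambda_{ij}=0$, it is read as $+\infty$ if $x_j>x_i$ or if $x_j=x_i$ and $j<i$, and as $-\infty$ otherwise. Empty sums are $0$ and $\Phi_0=1$. Then: (i) For every $\mathcal A\subset\mathcal I$, $\ell_{\mathcal A}$ is the stable tail dependence function of $\mathbf Z_{\mathcal A}+(1/\boldsymbol\alpha_{\mathcal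 A})V_0$, and suitably normalized componentwise maxima of $n$ independent copies of this vector converge in distribution to the Hüsler–Reiss distribution with Gumbel margins, $G(\mathbf y)=\exp\{-\ell_{\mathcal A}(e^{-\mathbf y})\}$. (ii) The stable tail dependence function of $\mathbf X$ is $$\ell_{\mathbf X}(\mathbf x)=\sum_{\mathcal A\subset\mathcal I,\ \mathcal B=\mathcal I\setminus\mathcal A}\ell_{\mathcal A}(\tilde{\mathbf x}_{\mathcal A})\,\Pr(\mathbf Z^*_{\mathcal A}>\mathbf c_{\mathcal A},\ \mathbf Z^*_{\mathcal B}<\mathbf c_{\mathcal B}),\qquad \mathbf x\in[0,\infty)^d,$$ where $\tilde x_i=x_i/\Phi(-c_i)$ and $\Phi$ is the standard normal distribution function. -/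

import Mathlib

open MeasureTheory ProbabilityTheory Filter Topology

noncomputable section

/-- The copula of a random vector `X` with continuous margins: the joint distribution function of
the probability integral transforms `F_i(X_i)`, where `F_i` is the distribution function of
`X_i`. -/
def copula {Ω ι : Type*} [MeasurableSpace Ω] (X : Ω → ι → ℝ) (P : Measure Ω) (u : ι → ℝ) : ℝ :=
  P.real {ω | ∀ i, cdf (P.map (fun ω' => X ω' i)) (X ω i) ≤ u i}

/-- `ℓ` is the stable tail dependence function of `X`: for every `x` in the nonnegative orthant,
`n * (1 - C(1 - x_1 / n, …, 1 - x_d / n)) → ℓ(x)`, where `C` is the copula of `X`. -/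
def HasStdf {Ω ι : Type*} [MeasurableSpace Ω] (X : Ω → ι → ℝ) (P : Measure Ω)
    (ℓ : (ι → ℝ) → ℝ) : Prop :=
  ∀ x : ι → ℝ, (∀ i, 0 ≤ x i) →
    Tendsto (fun n : ℕ => (n : ℝ) * (1 - copula X P (fun i => 1 - x i / n))) atTop (𝓝 (ℓ x))

/-- `G` is the limit of the distribution functions of suitably normalized componentwise maxima of
`n` independent copies of `X`; the componentwise maximum of `n` independent copies has as its
distribution function the `n`-th power of that of `X`. -/
def HasEVLimit {Ω ι : Type*} [MeasurableSpace Ω] (X : Ω → ι → ℝ) (P : Measure Ω)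
    (G : (ι → ℝ) → ℝ) : Prop :=
  ∃ a b : ℕ → ι → ℝ, (∀ n i, 0 < a n i) ∧
    ∀ y : ι → ℝ,
      Tendsto (fun n : ℕ => (P.real {ω | ∀ i, X ω i ≤ a n i * y i + b n i}) ^ n) atTop (𝓝 (G y))

/-- The partial correlation matrix `Σ̄^(j)` of the Hüsler–Reiss model with parameters `lam i j`. -/
def partialCorr {ι : Type*} [DecidableEq ι] (lam : ι → ι → ℝ) (j : ι) :
    Matrix {i // i ≠ j} {i // i ≠ j} ℝ :=
  Matrix.of fun i k =>
    if i = k then 1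
    else (lam k j ^ 2 + lam i j ^ 2 - lam k i ^ 2) / (2 * lam k j * lam i j)

/-- The Hüsler–Reiss stable tail dependence function with parameters `lam i j`,
`ℓ(x) = ∑ j, x_j * Φ_{d-1}({lam i j + log (x_j / x_i) / (2 * lam i j)}_{i ≠ j}; Σ̄^(j))`.
If `x_i = 0`, the `i`-th argument of `Φ_{d-1}` is `+∞`. If `lam i j = 0` (components `i` and `j`
completely dependent), the `i`-th argument is `+∞` or `-∞` according to whether `x_j > x_i` or
`x_j < x_i`; a tie `x_i = x_j` is resolved in favour of the smaller index, so that the common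
value is counted once. -/
def huslerReissStdf {ι : Type*} [Fintype ι] [LinearOrder ι] (lam : ι → ι → ℝ) (x : ι → ℝ) : ℝ :=
  ∑ j, x j * (multivariateGaussian 0 (partialCorr lam j)).real
    {z | ∀ i : {i // i ≠ j},
      x i = 0 ∨
      (0 < lam i j ∧ z i ≤ lam i j + Real.log (x j / x i) / (2 * lam i j)) ∨
      (lam i j = 0 ∧ (x i < x j ∨ (x i = x j ∧ j < (i : ι))))}

/-- The Hüsler–Reiss distribution function with standard Gumbel margins. -/
def huslerReissCdf {ι : Type*} [Fintype ι] [LinearOrder ι] (lam : ι → ι → ℝ) (y : ι → ℝ) : ℝ :=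
  Real.exp (-huslerReissStdf lam (fun i => Real.exp (-y i)))

/-- The additive factor model `X_i = Z_i + (1 / α_i) * V₀ * 1(Z*_i > c_i)`. -/
def factorModel {Ω ι : Type*} (Z Zs : Ω → ι → ℝ) (V₀ : Ω → ℝ) (α c : ι → ℝ) : Ω → ι → ℝ :=
  fun ω i => Z ω i + (1 / α i) * V₀ ω * (if c i < Zs ω i then 1 else 0)

/-- The subvector `Z_A + (1 / α_A) * V₀`. -/
def untruncatedModel {Ω ι : Type*} (Z : Ω → ι → ℝ) (V₀ : Ω → ℝ) (α : ι → ℝ) (A : Finset ι) :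
    Ω → A → ℝ :=
  fun ω i => Z ω i + (1 / α i) * V₀ ω

/-- The Hüsler–Reiss parameters `(α_i² - 2 ρ_{ij} α_i α_j + α_j²)^{1/2} / 2`, `i, j ∈ A`, where
`ρ_{ij}` is the covariance of `Z_i` and `Z_j` (their correlation if the variances are `1`). -/
def factorLam {Ω ι : Type*} [MeasurableSpace Ω] (Z : Ω → ι → ℝ) (P : Measure Ω) (α : ι → ℝ)
    (A : Finset ι) (i j : A) : ℝ :=
  Real.sqrt (α i ^ 2 - 2 * cov[fun ω => Z ω i, fun ω => Z ω j; P] * α i * α j + α j ^ 2) / 2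

/-- The standard normal distribution function `Φ`. -/
def stdNormalCdf (t : ℝ) : ℝ := cdf (gaussianReal 0 1) t

end

/-! Put `W_i = exp(α_i Z_i - α_i² / 2)`, a log-normal weight of mean one. The increasing map `t ↦
exp(α_i t - α_i² / 2)` sends `X_i` to `exp(V₀) W_i` when the factor is present and to `W_i` when it
is absent. Since `exp(V₀)` is standard Pareto and independent of the weights, a Breiman argument
gives `n P(max_i x_i exp(V₀) Y_i > n) → E max_i x_i Y_i`, while integrable terms without the factor
contribute `o(1 / n)` (`tendsto_mul_measureReal_exists_lt`). If `E Y_i = 1`, the transformed margins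
are asymptotically Pareto, and this limit is the stable tail dependence function
(`hasStdf_of_tendsto_exceedance`, `hasStdf_integral_iSup`).

In (i), `Y_i = W_i`. To evaluate `E max_i x_i W_i`, split according to the index `j` attaining the
maximum and use `W_j` as a change of measure. By Cameron–Martin this shifts the Gaussian vector, and
the event becomes an orthant event for standardized increments with covariance `partialCorr`
(`integral_iSup_eq_huslerReissStdf`). The limit for maxima is then `(1 - a_n / n) ^ n → exp(-ℓ)`.

In (ii), `Y_i = W_i 1(Z*_i > c_i) / Φ(-c_i)`. Splitting over the random set of indices with `Z*_i >
c_i`, which is independent of `Z`, turns the expectation into the mixture over subsets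
(`integral_iSup_truncated_eq_sum`). -/

lemma expMeasure_one_real_lt_exp_mul {m r : ℝ} (hm : 0 ≤ m) (hr : 0 < r) :
    (expMeasure 1).real {v | r < Real.exp v * m} = min 1 (m / r) := by
  have : IsProbabilityMeasure (expMeasure 1) := isProbabilityMeasure_expMeasure one_pos
  rcases hm.eq_or_lt with rfl | hm
  · simp [hr.not_gt]
  have hset : {v | r < Real.exp v * m} = (Set.Iic (Real.log (r / m)))ᶜ := by
    ext v
    simp only [Set.mem_ofPred_eq, Set.mem_compl_iff, Set.mem_Iic, not_le]
    rw [Real.log_lt_iff_lt_exp (by positivity), div_lt_iff₀ hm]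
  rw [hset, measureReal_compl measurableSet_Iic, probReal_univ, ← cdf_eq_real,
    cdf_expMeasure_eq one_pos]
  split_ifs with h
  · rw [one_mul, Real.exp_neg, Real.exp_log (by positivity), inv_div, sub_sub_cancel,
      min_eq_right]
    rw [div_le_one hr]
    by_contra! hlt
    exact absurd h (not_le.2 (Real.log_neg (by positivity) ((div_lt_one hm).2 hlt)))
  · rw [sub_zero, min_eq_left]
    rw [le_div_iff₀ hr, one_mul]
    by_contra! hlt
    exact h (Real.log_nonneg ((one_le_div hm).2 hlt.le))

/-! ### Tails of a Pareto factor times an independent integrable weight. -/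

section Tail

variable {Ω : Type*} [MeasurableSpace Ω] {P : Measure Ω} [IsProbabilityMeasure P]

/-- Fubini: independence makes the joint law a product, and for fixed `M` the inner probability is
the Pareto tail at level `r / M`. -/
lemma measureReal_lt_exp_mul_eq_integral {V M : Ω → ℝ} (hV : HasLaw V (expMeasure 1) P)
    (hM : AEMeasurable M P) (hM0 : ∀ ω, 0 ≤ M ω) (hind : IndepFun V M P) {r : ℝ} (hr : 0 < r) :
    P.real {ω | r < Real.exp (V ω) * M ω} = ∫ ω, min 1 (M ω / r) ∂P := by
  have : IsProbabilityMeasure (expMeasure 1) := isProbabilityMeasure_expMeasure one_pos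
  have hs : MeasurableSet {p : ℝ × ℝ | r < Real.exp p.1 * p.2} :=
    measurableSet_lt measurable_const (by fun_prop)
  have h1 : P {ω | r < Real.exp (V ω) * M ω}
      = (P.map (fun ω => (V ω, M ω))) {p : ℝ × ℝ | r < Real.exp p.1 * p.2} := by
    rw [Measure.map_apply_of_aemeasurable (hV.aemeasurable.prodMk hM) hs]; rfl
  rw [(indepFun_iff_map_prod_eq_prod_map_map hV.aemeasurable hM).1 hind, hV.map_eq,
    Measure.prod_apply_symm hs, lintegral_map' (measurable_measure_prodMk_right hs).aemeasurable hM]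
    at h1
  have h2 : ∀ ω, (expMeasure 1) ((fun x => (x, M ω)) ⁻¹' {p : ℝ × ℝ | r < Real.exp p.1 * p.2})
      = ENNReal.ofReal (min 1 (M ω / r)) := by
    intro ω
    rw [← expMeasure_one_real_lt_exp_mul (hM0 ω) hr, ofReal_measureReal]; rfl
  simp_rw [h2] at h1
  have h0 : ∀ ω, 0 ≤ min 1 (M ω / r) := fun ω => le_min zero_le_one (div_nonneg (hM0 ω) hr.le)
  rw [measureReal_def, h1, integral_eq_lintegral_of_nonneg_ae (ae_of_all _ h0)]
  exact (aemeasurable_const.min (hM.div_const r)).aestronglyMeasurable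

/-- A Breiman-type limit: if `V` is unit exponential and independent of the integrable `M ≥ 0`,
then `n * P(exp(V) * M > n) → E M`. -/
lemma tendsto_mul_measureReal_lt_exp_mul {V M : Ω → ℝ} (hV : HasLaw V (expMeasure 1) P)
    (hM : Integrable M P) (hM0 : ∀ ω, 0 ≤ M ω) (hind : IndepFun V M P) :
    Tendsto (fun n : ℕ => (n : ℝ) * P.real {ω | (n : ℝ) < Real.exp (V ω) * M ω}) atTop
      (𝓝 (∫ ω, M ω ∂P)) := by
  -- Multiplying `E min(1, M / n)` by `n` gives `E min(n, M)`, which is dominated by `M`.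
  have key : Tendsto (fun n : ℕ => ∫ ω, min (n : ℝ) (M ω) ∂P) atTop (𝓝 (∫ ω, M ω ∂P)) := by
    refine tendsto_integral_of_dominated_convergence M
      (fun n => (aemeasurable_const.min hM.aemeasurable).aestronglyMeasurable) hM
      (fun n => ae_of_all _ fun ω => ?_) (ae_of_all _ fun ω => ?_)
    · rw [Real.norm_of_nonneg (le_min n.cast_nonneg (hM0 ω))]
      exact min_le_right _ _
    · refine tendsto_const_nhds.congr' ?_
      filter_upwards [eventually_ge_atTop ⌈M ω⌉₊] with n hn
      exact (min_eq_right (Nat.ceil_le.1 hn)).symm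
  refine key.congr' ?_
  filter_upwards [eventually_gt_atTop 0] with n hn
  have hn' : (0 : ℝ) < n := by exact_mod_cast hn
  rw [measureReal_lt_exp_mul_eq_integral hV hM.aemeasurable hM0 hind hn', ← integral_const_mul]
  refine integral_congr_ae (ae_of_all _ fun ω => ?_)
  simp only
  rw [mul_min_of_nonneg _ _ hn'.le, mul_one, mul_div_cancel₀ _ hn'.ne']

end Tail

/-- The variables `n 1(M > n)` are bounded by `|M|` and vanish pointwise for large `n`. Hence
integrable perturbations are invisible at the scale `1 / n`. -/
lemma tendsto_mul_measureReal_lt_of_integrable {Ω : Type*} [MeasurableSpace Ω]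
    {P : Measure Ω} [IsFiniteMeasure P] {M : Ω → ℝ} (hM : Integrable M P) :
    Tendsto (fun n : ℕ => (n : ℝ) * P.real {ω | (n : ℝ) < M ω}) atTop (𝓝 0) := by
  have hns : ∀ n : ℕ, NullMeasurableSet {ω | (n : ℝ) < M ω} P := fun n =>
    nullMeasurableSet_lt aemeasurable_const hM.aemeasurable
  have key : Tendsto (fun n : ℕ => ∫ ω, {ω | (n : ℝ) < M ω}.indicator (fun _ => (n : ℝ)) ω ∂P)
      atTop (𝓝 (∫ _, (0 : ℝ) ∂P)) := by
    refine tendsto_integral_of_dominated_convergence (fun ω => |M ω|)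
      (fun n => ((aestronglyMeasurable_const).indicator₀ (hns n))) hM.abs
      (fun n => ae_of_all _ fun ω => ?_) (ae_of_all _ fun ω => ?_)
    · by_cases h : (n : ℝ) < M ω
      · simpa [Set.indicator, h] using h.le.trans (le_abs_self _)
      · simp [Set.indicator, h]
    · refine tendsto_const_nhds.congr' ?_
      filter_upwards [eventually_ge_atTop ⌈M ω⌉₊] with n hn
      simp [Set.indicator, Nat.ceil_le.1 hn]
  rw [integral_zero] at key
  refine key.congr fun n => ?_
  rw [integral_indicator₀ (hns n), setIntegral_const, smul_eq_mul, mul_comm]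

/-! ### From copula exceedances to exceedances of transformed variables. -/

section Stdf

variable {Ω ι : Type*} [MeasurableSpace Ω] {P : Measure Ω} [IsProbabilityMeasure P] [Finite ι]

/-- Exceedances of `1 - x_i / n` by the probability integral transforms may be replaced by
exceedances of `n` by `x_i * g_i(X_i)`, for increasing `g_i` for which `g_i(X_i)` has an
asymptotically standard Pareto tail. -/
lemma hasStdf_of_tendsto_exceedance {X : Ω → ι → ℝ} (hX : ∀ i, AEMeasurable (fun ω => X ω i) P)
    {g : ι → ℝ → ℝ} (hg : ∀ i, Monotone (g i)) {L : (ι → ℝ) → ℝ}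
    (hmarg : ∀ i, ∀ t : ℝ, 0 < t →
      Tendsto (fun n : ℕ => (n : ℝ) * P.real {ω | (n : ℝ) < t * g i (X ω i)}) atTop (𝓝 t))
    (hL : ∀ x : ι → ℝ, (∀ i, 0 ≤ x i) →
      Tendsto (fun n : ℕ => (n : ℝ) * P.real {ω | ∃ i, (n : ℝ) < x i * g i (X ω i)}) atTop
        (𝓝 (L x)))
    (hhom : ∀ x : ι → ℝ, (∀ i, 0 ≤ x i) → ∀ t : ℝ, 0 < t → L (fun i => t * x i) = t * L x) :
    HasStdf X P L := by
  intro x hx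
  set F : ι → ℝ → ℝ := fun i => cdf (P.map (fun ω' => X ω' i)) with hF
  have hprob : ∀ i, IsProbabilityMeasure (P.map (fun ω => X ω i)) := fun i =>
    Measure.isProbabilityMeasure_map (hX i)
  have hFapply : ∀ i t, 1 - F i t = P.real {ω | t < X ω i} := by
    intro i t
    have h1 : F i t = P.real {ω | X ω i ≤ t} := by
      rw [hF]; simp only
      rw [cdf_eq_real, map_measureReal_apply_of_aemeasurable (hX i) measurableSet_Iic]; rfl
    have h2 : {ω | t < X ω i} = {ω | X ω i ≤ t}ᶜ := by ext; simp
    rw [h1, h2, measureReal_compl₀ (nullMeasurableSet_le (hX i) aemeasurable_const), probReal_univ]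
  set p : ℕ → ℝ := fun n => P.real {ω | ∃ i, 1 - F i (X ω i) < x i / n} with hp
  have hcop : ∀ n : ℕ, 1 - copula X P (fun i => 1 - x i / n) = p n := by
    intro n
    have h2 : {ω | ∃ i, 1 - F i (X ω i) < x i / n}
        = {ω | ∀ i, F i (X ω i) ≤ 1 - x i / n}ᶜ := by
      ext ω
      simp only [Set.mem_ofPred_eq, Set.mem_compl_iff, not_forall, not_le]
      refine exists_congr fun i => ?_
      constructor <;> intro h <;> linarith
    have hns : NullMeasurableSet {ω | ∀ i, F i (X ω i) ≤ 1 - x i / n} P := by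
      rw [Set.ofPred_forall]
      exact NullMeasurableSet.iInter fun i => nullMeasurableSet_le
        ((monotone_cdf _).measurable.comp_aemeasurable (hX i)) aemeasurable_const
    rw [hp]; simp only
    rw [h2, measureReal_compl₀ hns, probReal_univ]
    rfl
  simp_rw [hcop]
  have hmono : ∀ s : ℝ, 0 ≤ s → ∀ i a b, a ≤ b → ∀ n : ℕ,
      (n : ℝ) < s * g i a → (n : ℝ) < s * g i b := fun s hs i a b hab n h =>
    h.trans_le (mul_le_mul_of_nonneg_left (hg i hab) hs)
  -- For `t > 1`, eventually `n P(t x_i g_i(X_i) > n) > x_i`. If `X_i ω` did not satisfy `n < t x_i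
  -- g_i`, monotonicity would put this whole event inside `{X_i > X_i ω}`, whose probability is
  -- below `x_i / n`.
  have hupper : ∀ t : ℝ, 1 < t → ∀ᶠ n : ℕ in atTop,
      p n ≤ P.real {ω | ∃ i, (n : ℝ) < t * x i * g i (X ω i)} := by
    intro t ht
    have hev : ∀ i, ∀ᶠ n : ℕ in atTop, 0 < x i →
        x i < (n : ℝ) * P.real {ω | (n : ℝ) < t * x i * g i (X ω i)} := by
      intro i
      by_cases hi : 0 < x i
      · filter_upwards [(hmarg i (t * x i) (by positivity)).eventually_const_lt
          (lt_mul_of_one_lt_left hi ht)] with n hn _ using hn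
      · exact Eventually.of_forall fun n h => absurd h hi
    filter_upwards [eventually_all.2 hev, eventually_gt_atTop 0] with n hn hn0
    have hn' : (0 : ℝ) < n := by exact_mod_cast hn0
    refine measureReal_mono ?_ (by finiteness)
    rintro ω ⟨i, hi⟩
    refine ⟨i, ?_⟩
    rw [hFapply] at hi
    have hxi : 0 < x i := by
      have := measureReal_nonneg.trans_lt hi
      by_contra! h
      exact absurd this (not_lt.2 (div_nonpos_of_nonpos_of_nonneg h hn'.le))
    by_contra! hlt
    have hsub : {ω' | (n : ℝ) < t * x i * g i (X ω' i)} ⊆ {ω' | X ω i < X ω' i} := by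
      intro ω' hω'
      simp only [Set.mem_ofPred_eq] at hω' ⊢
      by_contra! hle
      exact absurd (hmono (t * x i) (by positivity) i _ _ hle n hω') (not_lt.2 hlt)
    have h3 : P.real {ω' | (n : ℝ) < t * x i * g i (X ω' i)} < x i / n :=
      (measureReal_mono hsub (by finiteness)).trans_lt hi
    rw [lt_div_iff₀ hn', mul_comm] at h3
    exact lt_asymm h3 (hn i hxi)
  -- The mirror image: for `t < 1`, everything beyond a point with `n < t x_i g_i` lies in an event
  -- of probability below `x_i / n`.
  have hlower : ∀ t : ℝ, 0 < t → t < 1 → ∀ᶠ n : ℕ in atTop,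
      P.real {ω | ∃ i, (n : ℝ) < t * x i * g i (X ω i)} ≤ p n := by
    intro t ht0 ht
    have hev : ∀ i, ∀ᶠ n : ℕ in atTop, 0 < x i →
        (n : ℝ) * P.real {ω | (n : ℝ) < t * x i * g i (X ω i)} < x i := by
      intro i
      by_cases hi : 0 < x i
      · filter_upwards [(hmarg i (t * x i) (by positivity)).eventually_lt_const
          (mul_lt_of_lt_one_left hi ht)] with n hn _ using hn
      · exact Eventually.of_forall fun n h => absurd h hi
    filter_upwards [eventually_all.2 hev, eventually_gt_atTop 0] with n hn hn0
    have hn' : (0 : ℝ) < n := by exact_mod_cast hn0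
    refine measureReal_mono ?_ (by finiteness)
    rintro ω ⟨i, hi⟩
    refine ⟨i, ?_⟩
    rw [hFapply]
    have hxi : 0 < x i := by
      rcases (hx i).eq_or_lt with h | h
      · rw [← h, mul_zero, zero_mul] at hi; exact absurd hi (not_lt.2 hn'.le)
      · exact h
    have hsub : {ω' | X ω i < X ω' i} ⊆ {ω' | (n : ℝ) < t * x i * g i (X ω' i)} := by
      intro ω' hω'
      exact hmono (t * x i) (by positivity) i _ _ (le_of_lt hω') n hi
    rw [lt_div_iff₀ hn', mul_comm]
    exact (mul_le_mul_of_nonneg_left (measureReal_mono hsub (by finiteness)) hn'.le).trans_lt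
      (hn i hxi)
  have hlim : ∀ t : ℝ, 0 < t → Tendsto (fun n : ℕ => (n : ℝ) *
      P.real {ω | ∃ i, (n : ℝ) < t * x i * g i (X ω i)}) atTop (𝓝 (t * L x)) := by
    intro t ht
    rw [← hhom x hx t ht]
    exact hL _ fun i => mul_nonneg ht.le (hx i)
  have hcont : Tendsto (fun t : ℝ => t * L x) (𝓝 1) (𝓝 (L x)) := by
    simpa using (tendsto_id (α := ℝ) (x := 𝓝 1)).mul_const (L x)
  -- Homogeneity turns both bounds into `t * L x`, and `t` tends to `1` from either side.
  refine tendsto_order.2 ⟨fun a ha => ?_, fun a ha => ?_⟩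
  · have h1 : ∀ᶠ t in 𝓝[<] (1 : ℝ), a < t * L x :=
      (hcont.mono_left nhdsWithin_le_nhds).eventually_const_lt ha
    have h2 : ∀ᶠ t in 𝓝[<] (1 : ℝ), 0 < t :=
      nhdsWithin_le_nhds (lt_mem_nhds one_pos)
    obtain ⟨t, hta, ht0, ht1⟩ := (h1.and (h2.and self_mem_nhdsWithin)).exists
    filter_upwards [(hlim t ht0).eventually_const_lt hta, hlower t ht0 ht1] with n h3 h4
    exact h3.trans_le (mul_le_mul_of_nonneg_left h4 n.cast_nonneg)
  · have h1 : ∀ᶠ t in 𝓝[>] (1 : ℝ), t * L x < a :=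
      (hcont.mono_left nhdsWithin_le_nhds).eventually_lt_const ha
    obtain ⟨t, hta, ht1⟩ := (h1.and self_mem_nhdsWithin).exists
    have ht1' : (1 : ℝ) < t := ht1
    filter_upwards [(hlim t (by linarith)).eventually_lt_const hta, hupper t ht1'] with n h3 h4
    exact (mul_le_mul_of_nonneg_left h4 n.cast_nonneg).trans_lt h3

end Stdf

lemma lt_mul_ciSup_iff {ι : Type*} [Finite ι] {r s : ℝ} (hr : 0 ≤ r) (hs : 0 < s) (w : ι → ℝ) :
    r < s * ⨆ i, w i ↔ ∃ i, r < s * w i := by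
  rcases isEmpty_or_nonempty ι with h | h
  -- An empty real supremum is `0`, which does not exceed `r` because `0 ≤ r`.
  · simp [Real.iSup_of_isEmpty, hr]
  · rw [mul_comm, ← div_lt_iff₀ hs, lt_ciSup_iff (Set.finite_range w).bddAbove]
    simp_rw [div_lt_iff₀ hs, mul_comm]

/-- Completing the square: `exp(x - v / 2)` is the density of `N(v, v)` with respect to `N(0, v)`.
-/
lemma lintegral_exp_mul_gaussianReal {v : NNReal} (hv : v ≠ 0) {f : ℝ → ENNReal}
    (hf : Measurable f) :
    ∫⁻ x, ENNReal.ofReal (Real.exp (x - v / 2)) * f x ∂gaussianReal 0 v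
      = ∫⁻ x, f (x + v) ∂gaussianReal 0 v := by
  have h1 : ∫⁻ x, f (x + v) ∂gaussianReal 0 v = ∫⁻ x, f x ∂gaussianReal v v := by
    rw [← zero_add ((v : ℝ)), ← gaussianReal_map_add_const, lintegral_map hf (by fun_prop),
      zero_add]
  rw [h1, gaussianReal_of_var_ne_zero _ hv, gaussianReal_of_var_ne_zero _ hv,
    lintegral_withDensity_eq_lintegral_mul _ (measurable_gaussianPDF _ _) (by fun_prop),
    lintegral_withDensity_eq_lintegral_mul _ (measurable_gaussianPDF _ _) hf]
  refine lintegral_congr fun x => ?_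
  simp only [Pi.mul_apply]
  rw [← mul_assoc]
  congr 1
  rw [gaussianPDF, gaussianPDF, ← ENNReal.ofReal_mul (gaussianPDFReal_nonneg _ _ _)]
  congr 1
  rw [gaussianPDFReal, gaussianPDFReal, mul_assoc, ← Real.exp_add]
  congr 2
  have : (v : ℝ) ≠ 0 := by exact_mod_cast hv
  field_simp
  ring

/-! ### Exponential tilting and identification of Gaussian vectors. -/

section Gaussian

variable {Ω : Type*} [MeasurableSpace Ω] {P : Measure Ω} {κ : Type*} [Fintype κ]

/-- The Cameron–Martin formula for a Gaussian vector, tilted by one of its coordinates. -/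
lemma lintegral_exp_mul_comp_of_hasGaussianLaw {ξ : κ → Ω → ℝ}
    (hξ : HasGaussianLaw (fun ω k => ξ k ω) P) (j : κ) (hmean : ∫ ω, ξ j ω ∂P = 0)
    (hvar : Var[ξ j; P] ≠ 0) {f : (κ → ℝ) → ENNReal} (hf : Measurable f) :
    ∫⁻ ω, ENNReal.ofReal (Real.exp (ξ j ω - Var[ξ j; P] / 2)) * f (fun k => ξ k ω) ∂P
      = ∫⁻ ω, f (fun k => ξ k ω + cov[ξ k, ξ j; P]) ∂P := by
  have : IsProbabilityMeasure P := hξ.isProbabilityMeasure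
  set v : NNReal := Var[ξ j; P].toNNReal with hv
  have hvr : Var[ξ j; P] = v := (Real.coe_toNNReal _ (variance_nonneg _ _)).symm
  have hv0 : (v : ℝ) ≠ 0 := hvr ▸ hvar
  have hv0' : v ≠ 0 := by exact_mod_cast hv0
  have hL2 : ∀ k, MemLp (ξ k) 2 P := fun k => (hξ.eval k).memLp_two
  -- Regression on `ξ_j`: the residuals `R_k` are uncorrelated with `ξ_j`, hence jointly independent
  -- of it. The tilt therefore only shifts `ξ_j` by `v`, which moves `ξ_k` by `β_k v = cov(ξ_k,
  -- ξ_j)`.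
  set β : κ → ℝ := fun k => cov[ξ k, ξ j; P] / v with hβ
  set R : κ → Ω → ℝ := fun k ω => ξ k ω - β k * ξ j ω with hR
  have hlawj : P.map (ξ j) = gaussianReal 0 v := by
    rw [(hξ.eval j).map_eq_gaussianReal, hmean]
  have hindep : IndepFun (ξ j) (fun ω k => R k ω) P := by
    have hpair : HasGaussianLaw
        (fun ω => ((fun _ : Unit => ξ j ω), fun k => R k ω)) P :=
      hξ.map_fun ((ContinuousLinearMap.pi fun _ : Unit => ContinuousLinearMap.proj (R := ℝ)
        (φ := fun _ : κ => ℝ) j).prod (ContinuousLinearMap.pi fun k =>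
          ContinuousLinearMap.proj (R := ℝ) (φ := fun _ : κ => ℝ) k
            - β k • ContinuousLinearMap.proj (R := ℝ) (φ := fun _ : κ => ℝ) j))
    have h := HasGaussianLaw.indepFun_of_covariance_eval (X := fun _ : Unit => ξ j) (Y := R) hpair
      fun _ k => by
        rw [hR]
        simp only
        rw [covariance_fun_sub_right (hL2 j) (hL2 k) ((hL2 j).const_mul _),
          covariance_const_mul_right, covariance_self (hL2 j).aemeasurable, hvr, covariance_comm,
          hβ]
        simp only
        rw [div_mul_cancel₀ _ hv0, sub_self]
    exact h.comp (φ := fun z : Unit → ℝ => z ()) (ψ := id) (by fun_prop) measurable_id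
  have hRm : AEMeasurable (fun ω k => R k ω) P :=
    aemeasurable_pi_lambda _ fun k =>
      (hL2 k).aemeasurable.sub ((hL2 j).aemeasurable.const_mul _)
  have hjm : AEMeasurable (ξ j) P := (hL2 j).aemeasurable
  have hprod := (indepFun_iff_map_prod_eq_prod_map_map hjm hRm).1 hindep
  rw [hlawj] at hprod
  have hξR : ∀ ω k, ξ k ω = R k ω + β k * ξ j ω := fun ω k => by simp [hR]
  have hcomp : Measurable fun p : ℝ × (κ → ℝ) => f (fun k => p.2 k + β k * p.1) :=
    hf.comp (by fun_prop)
  have hcomp' : Measurable fun p : ℝ × (κ → ℝ) => f (fun k => p.2 k + β k * (p.1 + v)) :=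
    hf.comp (by fun_prop)
  have hprobR : IsProbabilityMeasure (P.map fun ω k => R k ω) :=
    Measure.isProbabilityMeasure_map hRm
  calc ∫⁻ ω, ENNReal.ofReal (Real.exp (ξ j ω - Var[ξ j; P] / 2)) * f (fun k => ξ k ω) ∂P
      = ∫⁻ p, ENNReal.ofReal (Real.exp (p.1 - v / 2)) * f (fun k => p.2 k + β k * p.1)
          ∂(P.map fun ω => (ξ j ω, fun k => R k ω)) := by
        rw [lintegral_map' (by fun_prop) (hjm.prodMk hRm), hvr]
        simp_rw [← hξR]
    _ = ∫⁻ p, f (fun k => p.2 k + β k * (p.1 + v))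
          ∂(P.map fun ω => (ξ j ω, fun k => R k ω)) := by
        rw [hprod, lintegral_prod_symm _ (by fun_prop), lintegral_prod_symm _ hcomp'.aemeasurable]
        refine lintegral_congr fun r => ?_
        exact lintegral_exp_mul_gaussianReal hv0' (f := fun x => f (fun k => r k + β k * x))
          (hf.comp (by fun_prop))
    _ = ∫⁻ ω, f (fun k => ξ k ω + cov[ξ k, ξ j; P]) ∂P := by
        rw [lintegral_map' hcomp'.aemeasurable (hjm.prodMk hRm)]
        refine lintegral_congr fun ω => ?_
        congr 1
        ext k
        simp only [hR, hβ]
        field_simp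
        ring

/-- Gaussian vectors with the same means and covariances have the same law. -/
lemma map_eq_map_of_hasGaussianLaw {Ω' : Type*} [MeasurableSpace Ω'] {P' : Measure Ω'}
    {X : κ → Ω → ℝ} {Y : κ → Ω' → ℝ} (hX : HasGaussianLaw (fun ω k => X k ω) P)
    (hY : HasGaussianLaw (fun ω k => Y k ω) P')
    (hmean : ∀ k, ∫ ω, X k ω ∂P = ∫ ω, Y k ω ∂P')
    (hcov : ∀ k l, cov[X k, X l; P] = cov[Y k, Y l; P']) :
    P.map (fun ω k => X k ω) = P'.map (fun ω k => Y k ω) := by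
  classical
  have : IsProbabilityMeasure P := hX.isProbabilityMeasure
  have : IsProbabilityMeasure P' := hY.isProbabilityMeasure
  have := hX.isGaussian_map
  have := hY.isGaussian_map
  -- A Gaussian characteristic function depends only on the mean and variance of each linear
  -- functional, which are determined by the coordinate means and covariances.
  refine Measure.ext_of_charFunDual (funext fun L => ?_)
  have hL : ∀ z : κ → ℝ, L z = ∑ k, L (Pi.single k 1) * z k := by
    intro z
    conv_lhs => rw [← Finset.univ_sum_single z, map_sum]
    refine Finset.sum_congr rfl fun k _ => ?_
    have : Pi.single k (z k) = z k • (Pi.single k 1 : κ → ℝ) := by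
      rw [← Pi.single_smul, smul_eq_mul, mul_one]
    rw [this, map_smul, smul_eq_mul, mul_comm]
  have hX2 : ∀ k, MemLp (X k) 2 P := fun k => (hX.eval k).memLp_two
  have hY2 : ∀ k, MemLp (Y k) 2 P' := fun k => (hY.eval k).memLp_two
  have hXL : (L ∘ fun ω k => X k ω) = fun ω => ∑ k, L (Pi.single k 1) * X k ω :=
    funext fun ω => hL _
  have hYL : (L ∘ fun ω k => Y k ω) = fun ω => ∑ k, L (Pi.single k 1) * Y k ω :=
    funext fun ω => hL _
  rw [hX.charFunDual_map_eq, hY.charFunDual_map_eq, hXL, hYL,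
    variance_fun_sum' fun k _ => (hX2 k).const_mul _,
    variance_fun_sum' fun k _ => (hY2 k).const_mul _,
    integral_finsetSum _ fun k _ => (hX.eval k).integrable.const_mul _,
    integral_finsetSum _ fun k _ => (hY.eval k).integrable.const_mul _]
  simp_rw [integral_const_mul, covariance_const_mul_left, covariance_const_mul_right, hmean, hcov]

/-- The quadratic form at `a` is the variance of `∑ k, a k * X k`. -/
lemma posSemidef_covariance {X : κ → Ω → ℝ} [IsProbabilityMeasure P]
    (hX : ∀ k, MemLp (X k) 2 P) :
    (Matrix.of fun k l => cov[X k, X l; P]).PosSemidef := by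
  refine Matrix.PosSemidef.of_dotProduct_mulVec_nonneg ?_ fun a => ?_
  · ext k l
    simp [covariance_comm]
  · have h := variance_nonneg (fun ω => ∑ k, a k * X k ω) P
    rw [variance_fun_sum' fun k _ => (hX k).const_mul _] at h
    simp_rw [covariance_const_mul_left, covariance_const_mul_right] at h
    refine h.trans_eq ?_
    rw [dotProduct]
    refine Finset.sum_congr rfl fun k _ => ?_
    rw [Matrix.mulVec, dotProduct, Finset.mul_sum]
    refine Finset.sum_congr rfl fun l _ => ?_
    simp only [Pi.star_apply, star_trivial, Matrix.of_apply]
    ring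

end Gaussian

/-- Breaking ties by the smallest index leaves exactly one maximizer, so one summand survives. The
rule matches the tie convention in `huslerReissStdf`. -/
lemma iSup_eq_sum_argmax {ι : Type*} [Fintype ι] [LinearOrder ι] (w : ι → ℝ) :
    ⨆ i, w i = ∑ j, {j | ∀ i, i ≠ j → w i < w j ∨ (w i = w j ∧ j < i)}.indicator w j := by
  classical
  rcases isEmpty_or_nonempty ι with h | h
  · simp
  obtain ⟨m, -, hm⟩ := Finset.exists_max_image Finset.univ w Finset.univ_nonempty
  set S : Finset ι := Finset.univ.filter fun i => w i = w m with hS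
  have hSne : S.Nonempty := ⟨m, by simp [hS]⟩
  set j := S.min' hSne with hj
  have hwj : w j = w m := by
    have := S.min'_mem hSne
    simpa [hS] using this
  have hlex : ∀ i, i ≠ j → w i < w j ∨ (w i = w j ∧ j < i) := by
    intro i hi
    rcases (hm i (Finset.mem_univ i)).lt_or_eq with h1 | h1
    · exact Or.inl (hwj ▸ h1)
    · refine Or.inr ⟨h1.trans hwj.symm, lt_of_le_of_ne (S.min'_le i ?_) hi.symm⟩
      simp [hS, h1]
  rw [Finset.sum_eq_single j]
  · rw [Set.indicator_of_mem (by exact hlex)]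
    refine le_antisymm (ciSup_le fun i => ?_) (le_ciSup (Set.finite_range w).bddAbove j)
    rw [hwj]
    exact hm i (Finset.mem_univ i)
  · intro k _ hk
    refine Set.indicator_of_notMem (fun hmem => ?_) _
    have h1 := hmem j hk.symm
    have h2 := hlex k hk
    rcases h1 with h1 | h1 <;> rcases h2 with h2 | h2
    · exact lt_asymm h1 h2
    · exact h1.ne h2.1.symm
    · exact h2.ne h1.1.symm
    · exact lt_asymm h1.2 h2.2
  · simp

/-! ### Covariances of Gaussian increments in terms of `lam`. -/

section HuslerReiss

variable {Ω : Type*} [MeasurableSpace Ω] {P : Measure Ω} {ι : Type*}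
  {ξ : ι → Ω → ℝ} {lam : ι → ι → ℝ}

lemma variance_sub_eq_of_lam (hlam : ∀ i j, lam i j = √(Var[fun ω => ξ i ω - ξ j ω; P]) / 2)
    (i j : ι) : Var[fun ω => ξ i ω - ξ j ω; P] = 4 * lam i j ^ 2 := by
  rw [hlam, div_pow, Real.sq_sqrt (variance_nonneg _ _)]
  ring

lemma variance_sub_eq_covariance (hξ : HasGaussianLaw (fun ω i => ξ i ω) P) (i j : ι) :
    Var[fun ω => ξ i ω - ξ j ω; P] = Var[ξ i; P] + Var[ξ j; P] - 2 * cov[ξ i, ξ j; P] := by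
  have : IsProbabilityMeasure P := hξ.isProbabilityMeasure
  have hL2 : ∀ k, MemLp (ξ k) 2 P := fun k => (hξ.eval k).memLp_two
  have hsub : AEMeasurable (fun ω => ξ i ω - ξ j ω) P :=
    (hL2 i).aemeasurable.sub (hL2 j).aemeasurable
  rw [← covariance_self hsub,
    covariance_fun_sub_fun_sub (hL2 i) (hL2 j) (hL2 i) (hL2 j),
    covariance_self (hL2 i).aemeasurable, covariance_self (hL2 j).aemeasurable,
    covariance_comm (ξ j) (ξ i)]
  ring

/-- Polarization, with each increment variance equal to `4 * lam ^ 2`. -/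
lemma covariance_sub_sub_eq_lam (hξ : HasGaussianLaw (fun ω i => ξ i ω) P)
    (hlam : ∀ i j, lam i j = √(Var[fun ω => ξ i ω - ξ j ω; P]) / 2) (i k j : ι) :
    cov[fun ω => ξ i ω - ξ j ω, fun ω => ξ k ω - ξ j ω; P]
      = 2 * (lam k j ^ 2 + lam i j ^ 2 - lam k i ^ 2) := by
  have : IsProbabilityMeasure P := hξ.isProbabilityMeasure
  have hL2 : ∀ k, MemLp (ξ k) 2 P := fun k => (hξ.eval k).memLp_two
  have h1 := variance_sub_eq_of_lam hlam k j
  have h2 := variance_sub_eq_of_lam hlam i j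
  have h3 := variance_sub_eq_of_lam hlam k i
  rw [variance_sub_eq_covariance hξ] at h1 h2 h3
  rw [covariance_fun_sub_fun_sub (hL2 i) (hL2 j) (hL2 k) (hL2 j),
    covariance_self (hL2 j).aemeasurable, covariance_comm (ξ i) (ξ k), covariance_comm (ξ j) (ξ k)]
  linarith

variable [DecidableEq ι]

/-- When `lam i j = 0`, division by zero makes the standardized increment `0`, whereas `partialCorr`
keeps a unit diagonal entry; the diagonal matrix accounts for the difference. Positive
semidefiniteness follows even in degenerate cases. -/
lemma partialCorr_eq_covariance_add_diagonal (hξ : HasGaussianLaw (fun ω i => ξ i ω) P)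
    (hlam : ∀ i j, lam i j = √(Var[fun ω => ξ i ω - ξ j ω; P]) / 2) (j : ι) :
    partialCorr lam j
      = (Matrix.of fun i k : {i // i ≠ j} => cov[fun ω => (ξ i ω - ξ j ω) / (2 * lam i j),
          fun ω => (ξ k ω - ξ j ω) / (2 * lam k j); P])
        + Matrix.diagonal fun i : {i // i ≠ j} => if lam i j = 0 then (1 : ℝ) else 0 := by
  ext i k
  rw [Matrix.add_apply, Matrix.of_apply, covariance_fun_div_left, covariance_fun_div_right,
    covariance_sub_sub_eq_lam hξ hlam]
  by_cases hik : i = k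
  · subst hik
    have h0 : lam i i = 0 := by
      have := variance_sub_eq_covariance hξ (i : ι) i
      rw [variance_sub_eq_of_lam hlam, covariance_self (hξ.eval (i : ι)).aemeasurable] at this
      nlinarith
    by_cases hl : lam i j = 0
    · simp [partialCorr, hl]
    · simp only [partialCorr, Matrix.of_apply, if_true, Matrix.diagonal_apply_eq, hl, if_false, h0]
      field_simp
      ring
  · simp only [partialCorr, Matrix.of_apply, hik, if_false, Matrix.diagonal_apply_ne _ hik,
      add_zero]
    by_cases h1 : lam i j = 0
    · simp [h1]
    by_cases h2 : lam k j = 0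
    · simp [h2]
    field_simp

variable [Fintype ι]

lemma posSemidef_partialCorr (hξ : HasGaussianLaw (fun ω i => ξ i ω) P)
    (hlam : ∀ i j, lam i j = √(Var[fun ω => ξ i ω - ξ j ω; P]) / 2) (j : ι) :
    (partialCorr lam j).PosSemidef := by
  have : IsProbabilityMeasure P := hξ.isProbabilityMeasure
  rw [partialCorr_eq_covariance_add_diagonal hξ hlam]
  refine (posSemidef_covariance fun i => ?_).add (Matrix.PosSemidef.diagonal fun i => ?_)
  · simp_rw [div_eq_mul_inv]
    exact ((hξ.eval (i : ι)).memLp_two.sub (hξ.eval j).memLp_two).mul_const _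
  · simp only [Pi.zero_apply]
    split_ifs <;> norm_num

/-- The standardized increments `(ξ_i - ξ_j) / (2 * lam i j)` with `lam i j ≠ 0` have the
covariance matrix `partialCorr lam j`; those with `lam i j = 0` are zero. -/
lemma map_standardized_increments (hξ : HasGaussianLaw (fun ω i => ξ i ω) P)
    (hmean : ∀ i, ∫ ω, ξ i ω ∂P = 0)
    (hlam : ∀ i j, lam i j = √(Var[fun ω => ξ i ω - ξ j ω; P]) / 2) (j : ι) :
    P.map (fun ω (i : {i // i ≠ j}) => (ξ i ω - ξ j ω) / (2 * lam i j))
      = (multivariateGaussian 0 (partialCorr lam j)).map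
          (fun z (i : {i // i ≠ j}) => if lam i j = 0 then 0 else z i) := by
  have : IsProbabilityMeasure P := hξ.isProbabilityMeasure
  set μ := multivariateGaussian 0 (partialCorr lam j)
  have hS := posSemidef_partialCorr hξ hlam j
  have hY : HasGaussianLaw (fun (z : EuclideanSpace ℝ {i // i ≠ j}) (i : {i // i ≠ j}) =>
      (if lam i j = 0 then 0 else 1) * z i) μ := by
    have := (IsGaussian.hasGaussianLaw_id (μ := μ)).map_fun (ContinuousLinearMap.pi
      fun i : {i // i ≠ j} => (if lam i j = 0 then (0 : ℝ) else 1) • EuclideanSpace.proj (𝕜 := ℝ) i)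
    exact this
  have hX : HasGaussianLaw (fun ω (i : {i // i ≠ j}) => (ξ i ω - ξ j ω) / (2 * lam i j)) P := by
    have := hξ.map_fun (ContinuousLinearMap.pi fun i : {i // i ≠ j} => (2 * lam i j)⁻¹ •
      (ContinuousLinearMap.proj (R := ℝ) (φ := fun _ : ι => ℝ) i
        - ContinuousLinearMap.proj (R := ℝ) (φ := fun _ : ι => ℝ) j))
    simpa [div_eq_inv_mul] using this
  have hY' : (fun (z : EuclideanSpace ℝ {i // i ≠ j}) (i : {i // i ≠ j}) =>
      if lam i j = 0 then 0 else z i) = fun (z : EuclideanSpace ℝ {i // i ≠ j}) (i : {i // i ≠ j}) =>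
        (if lam i j = 0 then 0 else 1) * z i := by
    ext z i; split_ifs <;> simp
  rw [hY']
  refine map_eq_map_of_hasGaussianLaw
    (X := fun (i : {i // i ≠ j}) ω => (ξ i ω - ξ j ω) / (2 * lam i j))
    (Y := fun (i : {i // i ≠ j}) (z : EuclideanSpace ℝ {i // i ≠ j}) =>
      (if lam i j = 0 then 0 else 1) * z i) hX hY (fun i => ?_) fun i k => ?_
  · have h0 : ∫ z, z i ∂μ = 0 := by
      have h := (EuclideanSpace.proj (𝕜 := ℝ) i).integral_comp_comm
        (IsGaussian.integrable_fun_id (μ := μ))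
      rw [integral_id_multivariateGaussian] at h
      simpa using h
    rw [integral_div, integral_sub (hξ.eval (i : ι)).integrable (hξ.eval j).integrable, hmean,
      hmean, integral_const_mul, h0]
    simp
  · rw [covariance_const_mul_left, covariance_const_mul_right,
      covariance_eval_multivariateGaussian hS,
      partialCorr_eq_covariance_add_diagonal hξ hlam, Matrix.add_apply, Matrix.of_apply]
    by_cases h1 : lam i j = 0
    · simp [h1]
    by_cases h2 : lam k j = 0
    · simp [h2]
    have h3 : Matrix.diagonal (fun i : {i // i ≠ j} => if lam i j = 0 then (1 : ℝ) else 0) i k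
        = 0 := by
      by_cases hik : i = k
      · subst hik; simp [h1]
      · exact Matrix.diagonal_apply_ne _ hik
    rw [h3]
    simp [h1, h2]

end HuslerReiss

/-! ### Expected maximum of weighted log-normal variables. -/

section MaxExpectation

variable {Ω : Type*} [MeasurableSpace Ω] {P : Measure Ω} {ι : Type*} [Fintype ι] [LinearOrder ι]
  {ξ : ι → Ω → ℝ} {lam : ι → ι → ℝ}

lemma measurableSet_forall_or_and_le_or {κ : Type*} [Countable κ] {E : Type*} [MeasurableSpace E]
    (p q r : κ → Prop) {f : κ → E → ℝ} (hf : ∀ i, Measurable (f i)) (b : κ → ℝ) :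
    MeasurableSet {z | ∀ i, p i ∨ (q i ∧ f i z ≤ b i) ∨ r i} := by
  rw [Set.ofPred_forall]
  exact MeasurableSet.iInter fun i => (MeasurableSet.const _).union
    (((MeasurableSet.const _).inter (measurableSet_le (hf i) measurable_const)).union
      (MeasurableSet.const _))

/-- The expectation of `exp(ξ_j - Var(ξ_j) / 2)` over the event that `j` attains the maximum of
`x_i * exp(ξ_i - Var(ξ_i) / 2)`. -/
lemma lintegral_exp_indicator_eq (hξ : HasGaussianLaw (fun ω i => ξ i ω) P)
    (hmean : ∀ i, ∫ ω, ξ i ω ∂P = 0) (hvar : ∀ i, Var[ξ i; P] ≠ 0)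
    (hlam : ∀ i j, lam i j = √(Var[fun ω => ξ i ω - ξ j ω; P]) / 2) (x : ι → ℝ) (j : ι) :
    ∫⁻ ω, ENNReal.ofReal (Real.exp (ξ j ω - Var[ξ j; P] / 2)) *
      {y : ι → ℝ | ∀ i : {i // i ≠ j}, x i = 0 ∨
        (0 < lam i j ∧ y i - y j ≤ Real.log (x j / x i) + Var[ξ i; P] / 2 - Var[ξ j; P] / 2) ∨
        (lam i j = 0 ∧ (x i < x j ∨ (x i = x j ∧ j < (i : ι))))}.indicator 1
          (fun i => ξ i ω) ∂P
      = multivariateGaussian 0 (partialCorr lam j)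
          {z | ∀ i : {i // i ≠ j}, x i = 0 ∨
            (0 < lam i j ∧ z i ≤ lam i j + Real.log (x j / x i) / (2 * lam i j)) ∨
            (lam i j = 0 ∧ (x i < x j ∨ (x i = x j ∧ j < (i : ι))))} := by
  have : IsProbabilityMeasure P := hξ.isProbabilityMeasure
  have hm : ∀ i, AEMeasurable (ξ i) P := fun i => (hξ.eval i).aemeasurable
  set S := {y : ι → ℝ | ∀ i : {i // i ≠ j}, x i = 0 ∨
        (0 < lam i j ∧ y i - y j ≤ Real.log (x j / x i) + Var[ξ i; P] / 2 - Var[ξ j; P] / 2) ∨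
        (lam i j = 0 ∧ (x i < x j ∨ (x i = x j ∧ j < (i : ι))))} with hS
  have hSm : MeasurableSet S := measurableSet_forall_or_and_le_or _ _ _ (by fun_prop) _
  set T := {z : {i // i ≠ j} → ℝ | ∀ i : {i // i ≠ j}, x i = 0 ∨
            (0 < lam i j ∧ z i ≤ lam i j + Real.log (x j / x i) / (2 * lam i j)) ∨
            (lam i j = 0 ∧ (x i < x j ∨ (x i = x j ∧ j < (i : ι))))} with hT
  have hTm : MeasurableSet T := measurableSet_forall_or_and_le_or _ _ _ (by fun_prop) _
  rw [lintegral_exp_mul_comp_of_hasGaussianLaw hξ j (hmean j) (hvar j)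
    (measurable_one.indicator hSm)]
  have hU : AEMeasurable (fun ω (i : {i // i ≠ j}) => (ξ i ω - ξ j ω) / (2 * lam i j)) P :=
    aemeasurable_pi_lambda _ fun i => ((hm i).sub (hm j)).div_const _
  have hproj : Measurable (fun (z : EuclideanSpace ℝ {i // i ≠ j}) (i : {i // i ≠ j}) =>
      if lam i j = 0 then 0 else z i) := by
    refine measurable_pi_lambda _ fun i => ?_
    split_ifs <;> fun_prop
  have h1 : ∀ ω, S.indicator (1 : (ι → ℝ) → ENNReal) (fun k => ξ k ω + cov[ξ k, ξ j; P])
      = ((fun ω (i : {i // i ≠ j}) => (ξ i ω - ξ j ω) / (2 * lam i j)) ⁻¹' T).indicator 1 ω := by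
    intro ω
    refine Set.indicator_eq_indicator ?_ rfl
    simp only [hS, hT, Set.mem_ofPred_eq, Set.mem_preimage]
    refine forall_congr' fun i => or_congr_right (or_congr_left (and_congr_right fun hl => ?_))
    -- The tilt shifts `ξ_i - ξ_j` by `cov(ξ_i, ξ_j) - Var ξ_j`. As `4 λ² = Var ξ_i + Var ξ_j - 2
    -- cov(ξ_i, ξ_j)`, the threshold becomes `log(x_j / x_i) + 2 λ²`, and division by `2 λ` gives
    -- the Hüsler–Reiss argument.
    have h2 := variance_sub_eq_of_lam hlam (i : ι) j
    rw [variance_sub_eq_covariance hξ] at h2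
    rw [div_le_iff₀ (by positivity), covariance_self (hm j), add_mul,
      div_mul_cancel₀ _ (by positivity)]
    constructor <;> intro h <;> nlinarith
  simp_rw [h1]
  rw [lintegral_indicator_one₀ (hU.nullMeasurableSet_preimage hTm),
    ← Measure.map_apply_of_aemeasurable hU hTm, map_standardized_increments hξ hmean hlam,
    Measure.map_apply hproj hTm]
  congr 1
  ext z
  simp only [hT, Set.mem_ofPred_eq, Set.mem_preimage]
  refine forall_congr' fun i => or_congr_right (or_congr_left (and_congr_right fun hl => ?_))
  rw [if_neg hl.ne']

/-- If `lam i j = 0`, then `ξ_i = ξ_j` almost surely with equal variances, so only `x_i`, `x_j` and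
the tie rule matter. If `lam i j > 0`, the increment has no atoms, so ties are null and `<` may be
replaced by `≤`. -/
lemma ae_forall_argmax_iff (hξ : HasGaussianLaw (fun ω i => ξ i ω) P)
    (hmean : ∀ i, ∫ ω, ξ i ω ∂P = 0)
    (hlam : ∀ i j, lam i j = √(Var[fun ω => ξ i ω - ξ j ω; P]) / 2) {x : ι → ℝ}
    (hx : ∀ i, 0 ≤ x i) {j : ι} (hxj : 0 < x j) :
    ∀ᵐ ω ∂P, (∀ i, i ≠ j →
      x i * Real.exp (ξ i ω - Var[ξ i; P] / 2) < x j * Real.exp (ξ j ω - Var[ξ j; P] / 2) ∨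
      (x i * Real.exp (ξ i ω - Var[ξ i; P] / 2) = x j * Real.exp (ξ j ω - Var[ξ j; P] / 2)
        ∧ j < i)) ↔
      ∀ i : {i // i ≠ j}, x i = 0 ∨
        (0 < lam i j ∧ ξ i ω - ξ j ω ≤
          Real.log (x j / x i) + Var[ξ i; P] / 2 - Var[ξ j; P] / 2) ∨
        (lam i j = 0 ∧ (x i < x j ∨ (x i = x j ∧ j < (i : ι)))) := by
  have : IsProbabilityMeasure P := hξ.isProbabilityMeasure
  have hm : ∀ i, AEMeasurable (ξ i) P := fun i => (hξ.eval i).aemeasurable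
  have hsub : ∀ i, HasGaussianLaw (fun ω => ξ i ω - ξ j ω) P := fun i =>
    hξ.map_fun (ContinuousLinearMap.proj (R := ℝ) (φ := fun _ : ι => ℝ) i
        - ContinuousLinearMap.proj (R := ℝ) (φ := fun _ : ι => ℝ) j)
  have hint : ∀ i, ∫ ω, ξ i ω - ξ j ω ∂P = 0 := fun i => by
    rw [integral_sub (hξ.eval i).integrable (hξ.eval j).integrable, hmean, hmean, sub_zero]
  have hae0 : ∀ᵐ ω ∂P, ∀ i, lam i j = 0 → ξ i ω = ξ j ω := by
    refine ae_all_iff.2 fun i => ?_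
    by_cases h : lam i j = 0
    · have hv : Var[fun ω => ξ i ω - ξ j ω; P] = 0 := by
        rw [variance_sub_eq_of_lam hlam, h]; ring
      filter_upwards [ae_eq_integral_of_variance_eq_zero (hsub i).memLp_two hv] with ω hω _
      rw [hint] at hω
      linarith
    · exact ae_of_all _ fun ω h' => absurd h' h
  have hvar0 : ∀ i, lam i j = 0 → Var[ξ i; P] = Var[ξ j; P] := fun i h =>
    variance_congr (hae0.mono fun ω hω => hω i h)
  have haepos : ∀ᵐ ω ∂P, ∀ i, 0 < lam i j →
      ξ i ω - ξ j ω ≠ Real.log (x j / x i) + Var[ξ i; P] / 2 - Var[ξ j; P] / 2 := by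
    refine ae_all_iff.2 fun i => ?_
    by_cases h : 0 < lam i j
    · have hv : Var[fun ω => ξ i ω - ξ j ω; P].toNNReal ≠ 0 := by
        rw [variance_sub_eq_of_lam hlam, ne_eq, Real.toNNReal_eq_zero, not_le]
        positivity
      have hlaw := (hsub i).map_eq_gaussianReal
      have hns := nullSingletonClass_gaussianReal (μ := ∫ ω, ξ i ω - ξ j ω ∂P) hv
      rw [← hlaw] at hns
      have h0 := measure_singleton (μ := P.map fun ω => ξ i ω - ξ j ω)
        (Real.log (x j / x i) + Var[ξ i; P] / 2 - Var[ξ j; P] / 2)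
      have h1 : ∀ᵐ y ∂(P.map fun ω => ξ i ω - ξ j ω),
          y ≠ Real.log (x j / x i) + Var[ξ i; P] / 2 - Var[ξ j; P] / 2 :=
        compl_mem_ae_iff.2 h0
      filter_upwards [ae_of_ae_map (hsub i).aemeasurable h1] with ω hω _ using hω
    · exact ae_of_all _ fun ω h' => absurd h' h
  have hlam0 : ∀ i, 0 ≤ lam i j := fun i => by rw [hlam]; positivity
  filter_upwards [hae0, haepos] with ω h0 hpos
  rw [Subtype.forall]
  refine forall_congr' fun i => forall_congr' fun hij => ?_
  simp only
  rcases (hx i).eq_or_lt with hxi | hxi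
  · rw [← hxi, zero_mul]
    simp only [true_or, iff_true]
    left; positivity
  rcases (hlam0 i).eq_or_lt with hl | hl
  · rw [h0 i hl.symm, hvar0 i hl.symm, mul_lt_mul_iff_left₀ (Real.exp_pos _),
      mul_left_inj' (Real.exp_pos _).ne']
    simp [hxi.ne', ← hl]
  · have hexp : ∀ k, 0 < x k → x k * Real.exp (ξ k ω - Var[ξ k; P] / 2)
        = Real.exp (Real.log (x k) + (ξ k ω - Var[ξ k; P] / 2)) := fun k hk => by
      rw [Real.exp_add, Real.exp_log hk]
    rw [hexp i hxi, hexp j hxj, Real.exp_lt_exp, Real.exp_eq_exp]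
    have hne := hpos i hl
    rw [Real.log_div hxj.ne' hxi.ne'] at hne ⊢
    simp only [hxi.ne', hl, hl.ne', true_and, false_and, or_false, false_or]
    constructor
    · rintro (h | ⟨h, -⟩) <;> linarith
    · intro h
      left
      have := lt_of_le_of_ne h hne
      linarith

/-- The spectral representation of the Hüsler–Reiss stable tail dependence function. -/
theorem integral_iSup_eq_huslerReissStdf (hξ : HasGaussianLaw (fun ω i => ξ i ω) P)
    (hmean : ∀ i, ∫ ω, ξ i ω ∂P = 0) (hvar : ∀ i, Var[ξ i; P] ≠ 0)
    (hlam : ∀ i j, lam i j = √(Var[fun ω => ξ i ω - ξ j ω; P]) / 2) {x : ι → ℝ}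
    (hx : ∀ i, 0 ≤ x i) (hint : ∀ i, Integrable (fun ω => Real.exp (ξ i ω - Var[ξ i; P] / 2)) P) :
    ∫ ω, ⨆ i, x i * Real.exp (ξ i ω - Var[ξ i; P] / 2) ∂P = huslerReissStdf lam x := by
  classical
  have hm : AEMeasurable (fun ω i => ξ i ω) P := hξ.aemeasurable
  set S : ι → Set (ι → ℝ) := fun j => {y : ι → ℝ | ∀ i : {i // i ≠ j}, x i = 0 ∨
        (0 < lam i j ∧ y i - y j ≤ Real.log (x j / x i) + Var[ξ i; P] / 2 - Var[ξ j; P] / 2) ∨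
        (lam i j = 0 ∧ (x i < x j ∨ (x i = x j ∧ j < (i : ι))))} with hS
  have hSm : ∀ j, MeasurableSet (S j) := fun j =>
    measurableSet_forall_or_and_le_or _ _ _ (by fun_prop) _
  have hae : ∀ᵐ ω ∂P, ⨆ i, x i * Real.exp (ξ i ω - Var[ξ i; P] / 2)
      = ∑ j, x j * (Real.exp (ξ j ω - Var[ξ j; P] / 2) *
          (S j).indicator 1 (fun i => ξ i ω)) := by
    have h1 : ∀ᵐ ω ∂P, ∀ j, 0 < x j → ((∀ i, i ≠ j →
      x i * Real.exp (ξ i ω - Var[ξ i; P] / 2) < x j * Real.exp (ξ j ω - Var[ξ j; P] / 2) ∨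
      (x i * Real.exp (ξ i ω - Var[ξ i; P] / 2) = x j * Real.exp (ξ j ω - Var[ξ j; P] / 2)
        ∧ j < i)) ↔ (fun i => ξ i ω) ∈ S j) := by
      refine ae_all_iff.2 fun j => ?_
      by_cases hxj : 0 < x j
      · filter_upwards [ae_forall_argmax_iff hξ hmean hlam hx hxj] with ω hω _ using hω
      · exact ae_of_all _ fun ω h => absurd h hxj
    filter_upwards [h1] with ω hω
    rw [iSup_eq_sum_argmax]
    refine Finset.sum_congr rfl fun j _ => ?_
    -- For `x_j = 0` both summands vanish, whichever index is selected; the almost sure equivalence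
    -- is needed only for `x_j > 0`.
    rcases (hx j).eq_or_lt with hxj | hxj
    · rw [← hxj, zero_mul]
      by_cases h : j ∈ {j | ∀ i, i ≠ j →
        x i * Real.exp (ξ i ω - Var[ξ i; P] / 2) < x j * Real.exp (ξ j ω - Var[ξ j; P] / 2) ∨
        (x i * Real.exp (ξ i ω - Var[ξ i; P] / 2) = x j * Real.exp (ξ j ω - Var[ξ j; P] / 2)
          ∧ j < i)}
      · rw [Set.indicator_of_mem h, ← hxj, zero_mul]
      · rw [Set.indicator_of_notMem h]
    · by_cases h : (fun i => ξ i ω) ∈ S j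
      · rw [Set.indicator_of_mem h, Set.indicator_of_mem (by exact (hω j hxj).2 h)]
        simp
      · rw [Set.indicator_of_notMem h,
          Set.indicator_of_notMem (by exact fun h' => h ((hω j hxj).1 h'))]
        simp
  have hfm : ∀ j, AEStronglyMeasurable (fun ω => Real.exp (ξ j ω - Var[ξ j; P] / 2) *
      (S j).indicator (1 : (ι → ℝ) → ℝ) (fun i => ξ i ω)) P := fun j =>
    (hint j).aestronglyMeasurable.mul
      ((measurable_one.indicator (hSm j)).comp_aemeasurable hm).aestronglyMeasurable
  have hind1 : ∀ j y, 0 ≤ (S j).indicator (1 : (ι → ℝ) → ℝ) y ∧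
      (S j).indicator (1 : (ι → ℝ) → ℝ) y ≤ 1 := fun j y => by
    by_cases h : y ∈ S j <;> simp [h]
  have hfi : ∀ j, Integrable (fun ω => Real.exp (ξ j ω - Var[ξ j; P] / 2) *
      (S j).indicator (1 : (ι → ℝ) → ℝ) (fun i => ξ i ω)) P := fun j => by
    refine (hint j).mono (hfm j) (ae_of_all _ fun ω => ?_)
    rw [norm_mul]
    refine mul_le_of_le_one_right (norm_nonneg _) ?_
    rw [Real.norm_of_nonneg (hind1 j _).1]
    exact (hind1 j _).2
  rw [integral_congr_ae hae, integral_finsetSum _ fun j _ => (hfi j).const_mul _, huslerReissStdf]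
  refine Finset.sum_congr rfl fun j _ => ?_
  rw [integral_const_mul]
  congr 1
  rw [integral_eq_lintegral_of_nonneg_ae
    (ae_of_all _ fun ω => mul_nonneg (Real.exp_pos _).le (hind1 j _).1) (hfm j), measureReal_def,
    ← lintegral_exp_indicator_eq hξ hmean hvar hlam x j]
  congr 1
  refine lintegral_congr fun ω => ?_
  rw [ENNReal.ofReal_mul (Real.exp_pos _).le]
  congr 1
  by_cases h : (fun i => ξ i ω) ∈ S j
  · rw [Set.indicator_of_mem h, Set.indicator_of_mem (by exact h)]; simp
  · rw [Set.indicator_of_notMem h, Set.indicator_of_notMem (by exact h)]; simp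

end MaxExpectation

/-! ### Spectral representation of the stable tail dependence function. -/

section Spectral

variable {Ω κ : Type*} [MeasurableSpace Ω] {P : Measure Ω} {V : Ω → ℝ} {Y N G : κ → Ω → ℝ}

lemma HasStdf.congr {X : Ω → κ → ℝ} {L L' : (κ → ℝ) → ℝ} (h : HasStdf X P L)
    (hL : ∀ x : κ → ℝ, (∀ i, 0 ≤ x i) → L x = L' x) : HasStdf X P L' :=
  fun x hx => hL x hx ▸ h x hx

variable [Fintype κ]

lemma integrable_iSup_mul {x : κ → ℝ} (hx : ∀ i, 0 ≤ x i) (hY : ∀ i, Integrable (Y i) P)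
    (hY0 : ∀ i ω, 0 ≤ Y i ω) : Integrable (fun ω => ⨆ i, x i * Y i ω) P := by
  have h0 : ∀ i ω, 0 ≤ x i * Y i ω := fun i ω => mul_nonneg (hx i) (hY0 i ω)
  refine (integrable_finsetSum Finset.univ fun i _ => (hY i).const_mul (x i)).mono
    (AEMeasurable.iSup fun i => ((hY i).aemeasurable.const_mul _)).aestronglyMeasurable
    (ae_of_all _ fun ω => ?_)
  have hs : 0 ≤ ∑ i, x i * Y i ω := Finset.sum_nonneg fun i _ => h0 i ω
  rw [Real.norm_of_nonneg (Real.iSup_nonneg fun i => h0 i ω), Real.norm_of_nonneg hs]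
  exact Real.iSup_le (fun i => Finset.single_le_sum (f := fun i => x i * Y i ω)
    (fun k _ => h0 k ω) (Finset.mem_univ i)) hs

variable [IsProbabilityMeasure P]

/-- If `G_i` equals `exp(V) * Y_i` up to an integrable perturbation `N_i`, then exceedances of high
levels by `x_i * G_i` are governed by `E max_i x_i * Y_i`. -/
lemma tendsto_mul_measureReal_exists_lt (hV : HasLaw V (expMeasure 1) P)
    (hY : ∀ i, Integrable (Y i) P) (hY0 : ∀ i ω, 0 ≤ Y i ω)
    (hind : IndepFun V (fun ω i => Y i ω) P) (hN : ∀ i, Integrable (N i) P)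
    (hlow : ∀ i ω, Real.exp (V ω) * Y i ω ≤ G i ω)
    (hup : ∀ i ω, G i ω ≤ max (Real.exp (V ω) * Y i ω) (N i ω))
    {x : κ → ℝ} (hx : ∀ i, 0 ≤ x i) :
    Tendsto (fun n : ℕ => (n : ℝ) * P.real {ω | ∃ i, (n : ℝ) < x i * G i ω}) atTop
      (𝓝 (∫ ω, ⨆ i, x i * Y i ω ∂P)) := by
  set M : Ω → ℝ := fun ω => ⨆ i, x i * Y i ω
  have hM0 : ∀ ω, 0 ≤ M ω := fun ω => Real.iSup_nonneg fun i => mul_nonneg (hx i) (hY0 i ω)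
  have hindM : IndepFun V M P :=
    hind.comp (φ := id) (ψ := fun y : κ → ℝ => ⨆ i, x i * y i) measurable_id
      (Measurable.iSup fun i => by fun_prop)
  have hmain := tendsto_mul_measureReal_lt_exp_mul hV (integrable_iSup_mul hx hY hY0) hM0 hindM
  -- By a union bound, this is all that the upper bound in `hup` adds to the probability governed by
  -- `exp(V) * M`.
  have hnoise : Tendsto (fun n : ℕ => ∑ i, (n : ℝ) * P.real {ω | (n : ℝ) < x i * N i ω}) atTop
      (𝓝 0) := by
    simpa using tendsto_finsetSum Finset.univ fun i _ =>
      tendsto_mul_measureReal_lt_of_integrable ((hN i).const_mul (x i))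
  have hM : ∀ (n : ℕ) ω, (n : ℝ) < Real.exp (V ω) * M ω ↔
      ∃ i, (n : ℝ) < x i * (Real.exp (V ω) * Y i ω) := fun n ω => by
    rw [lt_mul_ciSup_iff n.cast_nonneg (Real.exp_pos _)]
    simp_rw [mul_left_comm]
  refine tendsto_of_tendsto_of_tendsto_of_le_of_le hmain (by simpa using hmain.add hnoise)
    (fun n => ?_) (fun n => ?_)
  · refine mul_le_mul_of_nonneg_left (measureReal_mono (fun ω hω => ?_) (by finiteness))
      n.cast_nonneg
    obtain ⟨i, hi⟩ := (hM n ω).1 hω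
    exact ⟨i, hi.trans_le (mul_le_mul_of_nonneg_left (hlow i ω) (hx i))⟩
  · simp only
    rw [← Finset.mul_sum, ← mul_add]
    refine mul_le_mul_of_nonneg_left ?_ n.cast_nonneg
    have hsub : {ω | ∃ i, (n : ℝ) < x i * G i ω} ⊆
        {ω | (n : ℝ) < Real.exp (V ω) * M ω} ∪ ⋃ i, {ω | (n : ℝ) < x i * N i ω} := by
      rintro ω ⟨i, hi⟩
      have h1 := hi.trans_le (mul_le_mul_of_nonneg_left (hup i ω) (hx i))
      rw [mul_max_of_nonneg _ _ (hx i), lt_max_iff] at h1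
      rcases h1 with h1 | h1
      · exact Or.inl ((hM n ω).2 ⟨i, h1⟩)
      · exact Or.inr (Set.mem_iUnion.2 ⟨i, h1⟩)
    refine (measureReal_mono hsub (by finiteness)).trans ((measureReal_union_le _ _).trans ?_)
    gcongr
    exact measureReal_iUnion_fintype_le _

lemma hasStdf_integral_iSup {X : Ω → κ → ℝ} (hX : ∀ i, AEMeasurable (fun ω => X ω i) P)
    {g : κ → ℝ → ℝ} (hg : ∀ i, Monotone (g i)) (hV : HasLaw V (expMeasure 1) P)
    (hY : ∀ i, Integrable (Y i) P) (hY0 : ∀ i ω, 0 ≤ Y i ω) (hY1 : ∀ i, ∫ ω, Y i ω ∂P = 1)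
    (hind : IndepFun V (fun ω i => Y i ω) P) (hN : ∀ i, Integrable (N i) P)
    (hlow : ∀ i ω, Real.exp (V ω) * Y i ω ≤ g i (X ω i))
    (hup : ∀ i ω, g i (X ω i) ≤ max (Real.exp (V ω) * Y i ω) (N i ω)) :
    HasStdf X P (fun x => ∫ ω, ⨆ i, x i * Y i ω ∂P) := by
  refine hasStdf_of_tendsto_exceedance hX hg (fun i t ht => ?_) (fun x hx => ?_)
    fun x hx t ht => ?_
  -- The margins are the case of a one-point index set, with limit `t * E Y_i = t`.
  · have h := tendsto_mul_measureReal_exists_lt (κ := Unit) (Y := fun _ => Y i) (N := fun _ => N i)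
      (G := fun _ ω => g i (X ω i)) (x := fun _ => t) hV (fun _ => hY i) (fun _ => hY0 i)
      (hind.comp (φ := id) (ψ := fun (y : κ → ℝ) (_ : Unit) => y i) measurable_id (by fun_prop))
      (fun _ => hN i) (fun _ => hlow i) (fun _ => hup i) (fun _ => ht.le)
    simpa [integral_const_mul, hY1] using h
  · exact tendsto_mul_measureReal_exists_lt (G := fun i ω => g i (X ω i)) hV hY hY0 hind hN hlow
      hup hx
  · rw [← integral_const_mul]
    simp_rw [Real.mul_iSup_of_nonneg ht.le, mul_assoc]

end Spectral

/-- Zeros outside `A` cannot raise a maximum of nonnegative terms. For `A = ∅` both sides are `0`,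
by the convention for empty real suprema. -/
lemma iSup_ite_mem_eq {ι : Type*} [Finite ι] (A : Finset ι) [DecidablePred (· ∈ A)] {f : ι → ℝ}
    (hf : ∀ i, 0 ≤ f i) : ⨆ i, (if i ∈ A then f i else 0) = ⨆ i : A, f i := by
  refine le_antisymm (Real.iSup_le (fun i => ?_) (Real.iSup_nonneg fun i => hf i))
    (Real.iSup_le (fun i => ?_) (Real.iSup_nonneg fun i => ?_))
  · split_ifs with h
    · exact le_ciSup (f := fun i : A => f i) (Set.finite_range _).bddAbove ⟨i, h⟩
    · exact Real.iSup_nonneg fun i => hf i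
  · have := le_ciSup (f := fun i => if i ∈ A then f i else 0) (Set.finite_range _).bddAbove (i : ι)
    simpa using this
  · split_ifs
    exacts [hf i, le_rfl]

lemma stdNormalCdf_pos (t : ℝ) : 0 < stdNormalCdf t := by
  rw [stdNormalCdf, cdf_eq_real, measureReal_def, ENNReal.toReal_pos_iff]
  refine ⟨pos_iff_ne_zero.2 fun h => ?_, measure_lt_top _ _⟩
  have := gaussianReal_absolutelyContinuous' 0 (one_ne_zero (α := NNReal)) h
  simp at this

lemma gaussianReal_real_Ioi (t : ℝ) : (gaussianReal 0 1).real (Set.Ioi t) = stdNormalCdf (-t) := by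
  have := nullSingletonClass_gaussianReal (μ := 0) (one_ne_zero (α := NNReal))
  have h := gaussianReal_map_neg (μ := 0) (v := 1)
  rw [neg_zero] at h
  rw [stdNormalCdf, cdf_eq_real, ← h, map_measureReal_apply measurable_neg measurableSet_Iic]
  have h2 : (fun x : ℝ => -x) ⁻¹' Set.Iic (-t) = Set.Ici t := by ext; simp
  rw [h2, h]
  exact measureReal_congr Ioi_ae_eq_Ici

/-! ### Log-normal weights and the parameters of the model. -/

section FactorModel

variable {Ω ι : Type*} [MeasurableSpace Ω] {P : Measure Ω} {Z Zs : Ω → ι → ℝ} {V₀ : Ω → ℝ}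
  {α c : ι → ℝ}

lemma integrable_exp_mul_of_gaussian {X : Ω → ℝ} (hX : P.map X = gaussianReal 0 1) (a : ℝ) :
    Integrable (fun ω => Real.exp (a * X ω - a ^ 2 / 2)) P := by
  have hXm : AEMeasurable X P := aemeasurable_of_map_neZero (by rw [hX]; infer_instance)
  have h := integrable_exp_mul_gaussianReal (μ := 0) (v := 1) a
  rw [← hX] at h
  simp_rw [Real.exp_sub]
  exact (h.comp_aemeasurable hXm).div_const _

lemma integral_exp_mul_of_gaussian {X : Ω → ℝ} (hX : P.map X = gaussianReal 0 1) (a : ℝ) :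
    ∫ ω, Real.exp (a * X ω - a ^ 2 / 2) ∂P = 1 := by
  simp_rw [Real.exp_sub]
  rw [integral_div]
  have h := mgf_gaussianReal hX a
  rw [mgf] at h
  rw [h]
  simp

lemma map_eval_eq_gaussianReal (hZ : HasGaussianLaw Z P) (hmean : ∀ i, ∫ ω, Z ω i ∂P = 0)
    (hvar : ∀ i, Var[fun ω => Z ω i; P] = 1) (i : ι) :
    P.map (fun ω => Z ω i) = gaussianReal 0 1 := by
  rw [(HasGaussianLaw.eval (X := fun i ω => Z ω i) hZ i).map_eq_gaussianReal, hmean, hvar]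
  simp

/-- Take `ξ_i = α_i Z_i`: then `Var ξ_i = α_i²`, and the increment variances are the radicands in
`factorLam`. -/
lemma integral_iSup_eq_huslerReissStdf_factorLam [Fintype ι] [LinearOrder ι] (hα : ∀ i, 0 < α i)
    (hZ : HasGaussianLaw Z P) (hmean : ∀ i, ∫ ω, Z ω i ∂P = 0)
    (hvar : ∀ i, Var[fun ω => Z ω i; P] = 1) (A : Finset ι) {x : A → ℝ} (hx : ∀ i, 0 ≤ x i) :
    ∫ ω, ⨆ i, x i * Real.exp (α i * Z ω i - α i ^ 2 / 2) ∂P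
      = huslerReissStdf (factorLam Z P α A) x := by
  have hξ : HasGaussianLaw (fun ω (i : A) => α i * Z ω i) P := by
    have := hZ.map_fun (ContinuousLinearMap.pi fun i : A => α i •
      ContinuousLinearMap.proj (R := ℝ) (φ := fun _ : ι => ℝ) (i : ι))
    exact this
  have hv : ∀ i : A, Var[fun ω => α i * Z ω i; P] = α i ^ 2 := fun i => by
    rw [variance_const_mul, hvar, mul_one]
  have h := integral_iSup_eq_huslerReissStdf (lam := factorLam Z P α A)
    (ξ := fun (i : A) ω => α i * Z ω i) hξ
    (fun i => by rw [integral_const_mul, hmean, mul_zero])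
    (fun i => by rw [hv]; exact (pow_pos (hα i) 2).ne') (fun i j => ?_) hx
    (fun i => by
      simp_rw [hv]
      exact integrable_exp_mul_of_gaussian (map_eval_eq_gaussianReal hZ hmean hvar i) _)
  · simpa only [hv] using h
  · rw [factorLam, variance_sub_eq_covariance (ξ := fun (i : A) ω => α i * Z ω i) hξ, hv, hv,
      covariance_const_mul_left, covariance_const_mul_right]
    congr 2
    ring

end FactorModel

/-! ### Tail limits of the untruncated and truncated models. -/

section FactorModelLimits

variable {Ω ι : Type*} {Z Zs : Ω → ι → ℝ} {V₀ : Ω → ℝ} {α c : ι → ℝ}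

/-- Scaling by `α_i` cancels the loading `1 / α_i`, so all components share the same Pareto factor;
`-α_i² / 2` normalizes the remaining weight to mean one. -/
lemma exp_mul_untruncatedModel (hα : ∀ i, 0 < α i) (A : Finset ι) (i : A) (ω : Ω) :
    Real.exp (α i * untruncatedModel Z V₀ α A ω i - α i ^ 2 / 2)
      = Real.exp (V₀ ω) * Real.exp (α i * Z ω i - α i ^ 2 / 2) := by
  have := (hα i).ne'
  rw [untruncatedModel, ← Real.exp_add]
  congr 1
  field_simp
  ring

lemma exp_mul_factorModel (hα : ∀ i, 0 < α i) (i : ι) (ω : Ω) :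
    Real.exp (α i * factorModel Z Zs V₀ α c ω i - α i ^ 2 / 2)
      = Real.exp (if c i < Zs ω i then V₀ ω else 0) * Real.exp (α i * Z ω i - α i ^ 2 / 2) := by
  have := (hα i).ne'
  rw [factorModel, ← Real.exp_add]
  congr 1
  split_ifs
  · field_simp
    ring
  · ring

variable [MeasurableSpace Ω] {P : Measure Ω} [Fintype ι]

lemma aemeasurable_of_hasGaussianLaw_pair (hGauss : HasGaussianLaw (fun ω => (Z ω, Zs ω)) P) :
    (∀ i, AEMeasurable (fun ω => Z ω i) P) ∧ ∀ i, AEMeasurable (fun ω => Zs ω i) P :=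
  ⟨fun i => (measurable_pi_apply i).comp_aemeasurable hGauss.fst.aemeasurable,
    fun i => (measurable_pi_apply i).comp_aemeasurable hGauss.snd.aemeasurable⟩

variable [IsProbabilityMeasure P]

lemma hasStdf_untruncatedModel [LinearOrder ι] (hα : ∀ i, 0 < α i) (hZ : HasGaussianLaw Z P)
    (hmean : ∀ i, ∫ ω, Z ω i ∂P = 0) (hvar : ∀ i, Var[fun ω => Z ω i; P] = 1)
    (hV₀ : HasLaw V₀ (expMeasure 1) P) (hind : IndepFun V₀ Z P) (A : Finset ι) :
    HasStdf (untruncatedModel Z V₀ α A) P (huslerReissStdf (factorLam Z P α A)) := by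
  have hZm : ∀ i, AEMeasurable (fun ω => Z ω i) P := fun i =>
    (measurable_pi_apply i).comp_aemeasurable hZ.aemeasurable
  have hlaw := map_eval_eq_gaussianReal hZ hmean hvar
  refine (hasStdf_integral_iSup (X := untruncatedModel Z V₀ α A) (V := V₀)
    (g := fun i t => Real.exp (α i * t - α i ^ 2 / 2))
    (Y := fun (i : A) ω => Real.exp (α i * Z ω i - α i ^ 2 / 2)) (N := fun _ _ => 0)
    (fun i => (hZm i).add (hV₀.aemeasurable.const_mul _)) (fun i s t hst => ?_) hV₀
    (fun i => integrable_exp_mul_of_gaussian (hlaw i) _) (fun i ω => (Real.exp_pos _).le)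
    (fun i => integral_exp_mul_of_gaussian (hlaw i) _)
    (hind.comp (φ := id)
      (ψ := fun (z : ι → ℝ) (i : A) => Real.exp (α i * z i - α i ^ 2 / 2)) measurable_id
      (by fun_prop)) (fun i => integrable_zero _ _ _)
    (fun i ω => (exp_mul_untruncatedModel hα A i ω).ge)
    (fun i ω => (exp_mul_untruncatedModel hα A i ω).le.trans (le_max_left _ _))).congr
    fun x hx => integral_iSup_eq_huslerReissStdf_factorLam hα hZ hmean hvar A hx
  have := hα i
  simp only
  gcongr

lemma hasEVLimit_untruncatedModel [LinearOrder ι] (hα : ∀ i, 0 < α i) (hZ : HasGaussianLaw Z P)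
    (hmean : ∀ i, ∫ ω, Z ω i ∂P = 0) (hvar : ∀ i, Var[fun ω => Z ω i; P] = 1)
    (hV₀ : HasLaw V₀ (expMeasure 1) P) (hind : IndepFun V₀ Z P) (A : Finset ι) :
    HasEVLimit (untruncatedModel Z V₀ α A) P (huslerReissCdf (factorLam Z P α A)) := by
  have hZm : ∀ i, AEMeasurable (fun ω => Z ω i) P := fun i =>
    (measurable_pi_apply i).comp_aemeasurable hZ.aemeasurable
  have hlaw := map_eval_eq_gaussianReal hZ hmean hvar
  -- These constants are chosen so that `t ↦ α_i t - α_i² / 2` maps the level `a y_i + b` to `y_i +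
  -- log n`; non-exceedance then means `exp(-y_i) exp(V₀) W_i ≤ n`.
  refine ⟨fun _ i => 1 / α i, fun n i => (Real.log n + α i ^ 2 / 2) / α i,
    fun _ i => one_div_pos.2 (hα i), fun y => ?_⟩
  have h := tendsto_mul_measureReal_exists_lt (P := P) (κ := A) (V := V₀)
    (Y := fun (i : A) ω => Real.exp (α i * Z ω i - α i ^ 2 / 2)) (N := fun _ _ => 0)
    (G := fun i ω => Real.exp (V₀ ω) * Real.exp (α i * Z ω i - α i ^ 2 / 2))
    (x := fun i => Real.exp (-y i)) hV₀
    (fun i => integrable_exp_mul_of_gaussian (hlaw i) _) (fun i ω => (Real.exp_pos _).le)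
    (hind.comp (φ := id)
      (ψ := fun (z : ι → ℝ) (i : A) => Real.exp (α i * z i - α i ^ 2 / 2)) measurable_id
      (by fun_prop)) (fun i => integrable_zero _ _ _) (fun i ω => le_rfl)
    (fun i ω => le_max_left _ _) (fun i => (Real.exp_pos _).le)
  rw [integral_iSup_eq_huslerReissStdf_factorLam hα hZ hmean hvar A
    fun i => (Real.exp_pos _).le] at h
  rw [huslerReissCdf]
  have h' := h.neg
  simp_rw [← mul_neg] at h'
  refine (Real.tendsto_one_add_pow_exp_of_tendsto h').congr' ?_
  filter_upwards [eventually_gt_atTop 0] with n hn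
  have hn' : (0 : ℝ) < n := by exact_mod_cast hn
  congr 1
  have hset : {ω | ∀ i : A, untruncatedModel Z V₀ α A ω i
        ≤ 1 / α i * y i + (Real.log n + α i ^ 2 / 2) / α i}
      = {ω | ∃ i : A, (n : ℝ) < Real.exp (-y i) *
          (Real.exp (V₀ ω) * Real.exp (α i * Z ω i - α i ^ 2 / 2))}ᶜ := by
    ext ω
    simp only [Set.mem_ofPred_eq, Set.mem_compl_iff, not_exists, not_lt]
    refine forall_congr' fun i => ?_
    have hi := hα i
    rw [← exp_mul_untruncatedModel hα A i ω, ← Real.exp_add, ← Real.le_log_iff_exp_le hn',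
      one_div_mul_eq_div, ← add_div, le_div_iff₀ hi]
    constructor <;> intro h <;> linarith
  rw [hset, measureReal_compl₀ ?_, probReal_univ, sub_eq_add_neg]
  rw [Set.ofPred_exists]
  refine NullMeasurableSet.iUnion fun i => nullMeasurableSet_lt aemeasurable_const ?_
  have := hZm i
  have := hV₀.aemeasurable
  fun_prop

/-- The spectral representation of the factor model, conditioned on the set of components that
carry the common factor. -/
lemma integral_iSup_truncated_eq_sum [LinearOrder ι] (hα : ∀ i, 0 < α i)
    (hGauss : HasGaussianLaw (fun ω => (Z ω, Zs ω)) P)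
    (hZmean : ∀ i, ∫ ω, Z ω i ∂P = 0) (hZsmean : ∀ i, ∫ ω, Zs ω i ∂P = 0)
    (hZvar : ∀ i, Var[fun ω => Z ω i; P] = 1) (hZsvar : ∀ i, Var[fun ω => Zs ω i; P] = 1)
    (hindep : IndepFun Z Zs P) {x : ι → ℝ} (hx : ∀ i, 0 ≤ x i) :
    ∫ ω, ⨆ i, x i * (if c i < Zs ω i then Real.exp (α i * Z ω i - α i ^ 2 / 2) else 0) ∂P
      = ∑ A : Finset ι, huslerReissStdf (factorLam Z P α A) (fun i : A => x i) *
          P.real {ω | (∀ i ∈ A, c i < Zs ω i) ∧ ∀ i ∉ A, Zs ω i < c i} := by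
  classical
  obtain ⟨hZm, hZsm⟩ := aemeasurable_of_hasGaussianLaw_pair hGauss
  have hlaw := map_eval_eq_gaussianReal hGauss.fst hZmean hZvar
  have hlaws := map_eval_eq_gaussianReal hGauss.snd hZsmean hZsvar
  set T : Finset ι → Set (ι → ℝ) := fun A => {z | (∀ i ∈ A, c i < z i) ∧ ∀ i ∉ A, z i < c i}
    with hT
  have hTm : ∀ A, MeasurableSet (T A) := fun A => by
    simp only [hT, Set.ofPred_and, Set.ofPred_forall]
    exact (MeasurableSet.iInter fun i => MeasurableSet.iInter fun _ =>
      measurableSet_lt measurable_const (measurable_pi_apply i)).inter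
      (MeasurableSet.iInter fun i => MeasurableSet.iInter fun _ =>
        measurableSet_lt (measurable_pi_apply i) measurable_const)
  set M : (A : Finset ι) → (ι → ℝ) → ℝ := fun A z =>
    ⨆ i : A, x i * Real.exp (α i * z i - α i ^ 2 / 2) with hM
  have hMm : ∀ A, Measurable (M A) := fun A => Measurable.iSup fun i => by fun_prop
  -- With ties `Z*_i = c_i` excluded, exactly one of the events `T A` occurs, namely that of the
  -- random exceedance set `B`.
  have hne : ∀ᵐ ω ∂P, ∀ i, Zs ω i ≠ c i := by
    refine ae_all_iff.2 fun i => ?_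
    have hns := nullSingletonClass_gaussianReal (μ := 0) (one_ne_zero (α := NNReal))
    rw [← hlaws i] at hns
    have h1 : ∀ᵐ y ∂(P.map fun ω => Zs ω i), y ≠ c i := compl_mem_ae_iff.2 (measure_singleton _)
    exact ae_of_ae_map (hZsm i) h1
  have hae : ∀ᵐ ω ∂P,
      ⨆ i, x i * (if c i < Zs ω i then Real.exp (α i * Z ω i - α i ^ 2 / 2) else 0)
        = ∑ A, M A (Z ω) * (T A).indicator 1 (Zs ω) := by
    filter_upwards [hne] with ω hω
    set B : Finset ι := Finset.univ.filter fun i => c i < Zs ω i with hB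
    have hmemB : ∀ i, i ∈ B ↔ c i < Zs ω i := fun i => by simp [hB]
    rw [Finset.sum_eq_single B]
    · have hBT : Zs ω ∈ T B := ⟨fun i hi => (hmemB i).1 hi, fun i hi =>
        lt_of_le_of_ne (not_lt.1 fun h => hi ((hmemB i).2 h)) (hω i)⟩
      rw [Set.indicator_of_mem hBT, Pi.one_apply, mul_one, hM]
      simp only
      rw [← iSup_ite_mem_eq B (f := fun i => x i * Real.exp (α i * Z ω i - α i ^ 2 / 2))
        fun i => mul_nonneg (hx i) (Real.exp_pos _).le]
      simp_rw [hmemB, mul_ite, mul_zero]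
    · intro A _ hA
      rw [Set.indicator_of_notMem, mul_zero]
      rintro ⟨h1, h2⟩
      refine hA (Finset.ext fun i => ⟨fun hi => (hmemB i).2 (h1 i hi), fun hi => ?_⟩)
      by_contra hiA
      exact lt_asymm (h2 i hiA) ((hmemB i).1 hi)
    · simp
  have hMi : ∀ A, Integrable (fun ω => M A (Z ω)) P := fun A =>
    integrable_iSup_mul (x := fun i : A => x i)
      (Y := fun (i : A) ω => Real.exp (α i * Z ω i - α i ^ 2 / 2)) (fun i => hx i)
      (fun i => integrable_exp_mul_of_gaussian (hlaw i) _) (fun i ω => (Real.exp_pos _).le)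
  have hTi : ∀ A, Integrable (fun ω => (T A).indicator (1 : (ι → ℝ) → ℝ) (Zs ω)) P := fun A => by
    refine Integrable.of_bound ((measurable_one.indicator (hTm A)).comp_aemeasurable
      hGauss.snd.aemeasurable).aestronglyMeasurable 1 (ae_of_all _ fun ω => ?_)
    by_cases h : Zs ω ∈ T A <;> simp [h]
  have hind : ∀ A, IndepFun (fun ω => M A (Z ω))
      (fun ω => (T A).indicator (1 : (ι → ℝ) → ℝ) (Zs ω)) P := fun A =>
    hindep.comp (hMm A) (measurable_one.indicator (hTm A))
  have hprod : ∀ A, Integrable (fun ω => M A (Z ω) * (T A).indicator 1 (Zs ω)) P := fun A =>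
    (hind A).integrable_mul (hMi A) (hTi A)
  rw [integral_congr_ae hae, integral_finsetSum _ fun A _ => hprod A]
  refine Finset.sum_congr rfl fun A _ => ?_
  rw [(hind A).integral_fun_mul_eq_mul_integral (hMi A).aestronglyMeasurable
    (hTi A).aestronglyMeasurable]
  congr 1
  · exact integral_iSup_eq_huslerReissStdf_factorLam hα hGauss.fst hZmean hZvar A fun i => hx i
  · have h1 := integral_map hGauss.snd.aemeasurable
      (f := (T A).indicator (1 : (ι → ℝ) → ℝ))
      (measurable_one.indicator (hTm A)).aestronglyMeasurable
    rw [← h1, integral_indicator_one (hTm A),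
      map_measureReal_apply_of_aemeasurable hGauss.snd.aemeasurable (hTm A)]
    rfl

/-- By independence of `Z` and `Z*`, the truncated weight `W_i 1(Z*_i > c_i)` has mean `Φ(-c_i)`.
Dividing by it restores mean one and is the source of the rescaled argument `x_i / Φ(-c_i)`. -/
lemma hasStdf_factorModel [LinearOrder ι] (hα : ∀ i, 0 < α i)
    (hGauss : HasGaussianLaw (fun ω => (Z ω, Zs ω)) P)
    (hZmean : ∀ i, ∫ ω, Z ω i ∂P = 0) (hZsmean : ∀ i, ∫ ω, Zs ω i ∂P = 0)
    (hZvar : ∀ i, Var[fun ω => Z ω i; P] = 1) (hZsvar : ∀ i, Var[fun ω => Zs ω i; P] = 1)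
    (hV₀ : HasLaw V₀ (expMeasure 1) P)
    (hV₀indep : IndepFun V₀ (fun ω => (Z ω, Zs ω)) P) (hindep : IndepFun Z Zs P) :
    HasStdf (factorModel Z Zs V₀ α c) P (fun x =>
      ∑ A : Finset ι,
        huslerReissStdf (factorLam Z P α A) (fun i : A => x i / stdNormalCdf (-c i)) *
          P.real {ω | (∀ i ∈ A, c i < Zs ω i) ∧ ∀ i ∉ A, Zs ω i < c i}) := by
  obtain ⟨hZm, hZsm⟩ := aemeasurable_of_hasGaussianLaw_pair hGauss
  have hlaw := map_eval_eq_gaussianReal hGauss.fst hZmean hZvar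
  have hlaws := map_eval_eq_gaussianReal hGauss.snd hZsmean hZsvar
  have hΦ : ∀ i, 0 < stdNormalCdf (-c i) := fun i => stdNormalCdf_pos _
  set s : ι → ℝ → ℝ := fun i t => (Set.Ioi (c i)).indicator 1 t with hs
  have hsm : ∀ i, Measurable (s i) := fun i => measurable_one.indicator measurableSet_Ioi
  have hs1 : ∀ i t, c i < t → s i t = 1 := fun i t h => Set.indicator_of_mem (by exact h) _
  have hs0 : ∀ i t, ¬ c i < t → s i t = 0 := fun i t h => Set.indicator_of_notMem (by exact h) _
  set Y : ι → Ω → ℝ := fun i ω =>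
    Real.exp (α i * Z ω i - α i ^ 2 / 2) * s i (Zs ω i) / stdNormalCdf (-c i) with hY
  have hWi : ∀ i, Integrable (fun ω => Real.exp (α i * Z ω i - α i ^ 2 / 2)) P := fun i =>
    integrable_exp_mul_of_gaussian (hlaw i) _
  have hsi : ∀ i, Integrable (fun ω => s i (Zs ω i)) P := fun i => by
    refine Integrable.of_bound ((hsm i).comp_aemeasurable (hZsm i)).aestronglyMeasurable 1
      (ae_of_all _ fun ω => ?_)
    by_cases h : c i < Zs ω i
    · simp [hs1 i _ h]
    · simp [hs0 i _ h]
  have hWs : ∀ i, IndepFun (fun ω => Real.exp (α i * Z ω i - α i ^ 2 / 2))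
      (fun ω => s i (Zs ω i)) P := fun i =>
    hindep.comp (φ := fun z : ι → ℝ => Real.exp (α i * z i - α i ^ 2 / 2))
      (ψ := fun z : ι → ℝ => s i (z i)) (by fun_prop) ((hsm i).comp (measurable_pi_apply i))
  have hYi : ∀ i, Integrable (Y i) P := fun i =>
    ((hWs i).integrable_mul (hWi i) (hsi i)).div_const _
  have hY0 : ∀ i ω, 0 ≤ Y i ω := fun i ω => by
    have h := hΦ i
    have : 0 ≤ s i (Zs ω i) := Set.indicator_nonneg (fun _ _ => zero_le_one) _
    simp only [hY]
    positivity
  have hY1 : ∀ i, ∫ ω, Y i ω ∂P = 1 := fun i => by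
    have h1 : ∫ ω, s i (Zs ω i) ∂P = stdNormalCdf (-c i) := by
      have h := integral_map (hZsm i) (f := s i) (hsm i).aestronglyMeasurable
      rw [← h, hlaws, integral_indicator_one measurableSet_Ioi, gaussianReal_real_Ioi]
    simp only [hY]
    rw [integral_div, (hWs i).integral_fun_mul_eq_mul_integral (hWi i).aestronglyMeasurable
      (hsi i).aestronglyMeasurable, integral_exp_mul_of_gaussian (hlaw i), h1, one_mul,
      div_self (hΦ i).ne']
  have hYind : IndepFun V₀ (fun ω i => Y i ω) P := by
    refine hV₀indep.comp (φ := id) (ψ := fun (p : (ι → ℝ) × (ι → ℝ)) (i : ι) =>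
      Real.exp (α i * p.1 i - α i ^ 2 / 2) * s i (p.2 i) / stdNormalCdf (-c i)) measurable_id
      (measurable_pi_lambda _ fun i => ?_)
    have : Measurable fun p : (ι → ℝ) × (ι → ℝ) => s i (p.2 i) := (hsm i).comp (by fun_prop)
    exact (Measurable.mul (by fun_prop) this).div_const _
  have hXm : ∀ i, AEMeasurable (fun ω => factorModel Z Zs V₀ α c ω i) P := fun i => by
    have h : (fun ω => factorModel Z Zs V₀ α c ω i)
        = fun ω => Z ω i + 1 / α i * V₀ ω * s i (Zs ω i) := by
      ext ω
      rw [factorModel]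
      by_cases h : c i < Zs ω i
      · simp [hs1 i _ h, h]
      · simp [hs0 i _ h, h]
    rw [h]
    exact (hZm i).add ((hV₀.aemeasurable.const_mul _).mul ((hsm i).comp_aemeasurable (hZsm i)))
  -- Without the factor, what remains is an integrable log-normal variable; it serves as the
  -- perturbation `N_i`.
  have hmodel : ∀ i ω, Real.exp (α i * factorModel Z Zs V₀ α c ω i - α i ^ 2 / 2)
        / stdNormalCdf (-c i)
      = if c i < Zs ω i then Real.exp (V₀ ω) * Y i ω
        else Real.exp (α i * Z ω i - α i ^ 2 / 2) / stdNormalCdf (-c i) := fun i ω => by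
    rw [exp_mul_factorModel hα]
    simp only [hY]
    split_ifs with h
    · rw [hs1 i _ h, mul_one, mul_div_assoc]
    · rw [Real.exp_zero, one_mul]
  refine (hasStdf_integral_iSup (V := V₀) (Y := Y)
    (N := fun i ω => Real.exp (α i * Z ω i - α i ^ 2 / 2) / stdNormalCdf (-c i))
    (g := fun i t => Real.exp (α i * t - α i ^ 2 / 2) / stdNormalCdf (-c i)) hXm
    (fun i a b hab => ?_) hV₀ hYi hY0 hY1 hYind (fun i => (hWi i).div_const _)
    (fun i ω => ?_) (fun i ω => ?_)).congr fun x hx => ?_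
  · have h1 := hα i
    have h2 := hΦ i
    simp only
    gcongr
  · rw [hmodel]
    split_ifs with h
    · rfl
    · have h2 := hΦ i
      simp only [hY]
      rw [hs0 i _ h]
      simp only [mul_zero, zero_div]
      positivity
  · rw [hmodel]
    split_ifs with h
    · exact le_max_left _ _
    · exact le_max_right _ _
  · rw [← integral_iSup_truncated_eq_sum hα hGauss hZmean hZsmean hZvar hZsvar hindep
      (x := fun i => x i / stdNormalCdf (-c i)) fun i => div_nonneg (hx i) (hΦ i).le]
    congr 1
    ext ω
    congr 1
    ext i
    simp only [hY]
    split_ifs with h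
    · rw [hs1 i _ h]; ring
    · rw [hs0 i _ h]; ring

end FactorModelLimits

theorem proposition2 {Ω : Type*} [MeasurableSpace Ω] (P : Measure Ω) [IsProbabilityMeasure P]
    (d : ℕ) (Z Zs : Ω → Fin d → ℝ) (V₀ : Ω → ℝ) (α c : Fin d → ℝ)
    (hα : ∀ i, 0 < α i)
    (hGauss : HasGaussianLaw (fun ω => (Z ω, Zs ω)) P)
    (hZmean : ∀ i, ∫ ω, Z ω i ∂P = 0) (hZsmean : ∀ i, ∫ ω, Zs ω i ∂P = 0)
    (hZvar : ∀ i, Var[fun ω => Z ω i; P] = 1) (hZsvar : ∀ i, Var[fun ω => Zs ω i; P] = 1)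
    (hV₀ : HasLaw V₀ (expMeasure 1) P)
    (hV₀indep : IndepFun V₀ (fun ω => (Z ω, Zs ω)) P)
    (hindep : IndepFun Z Zs P) :
    (∀ A : Finset (Fin d),
      HasStdf (untruncatedModel Z V₀ α A) P (huslerReissStdf (factorLam Z P α A)) ∧
      HasEVLimit (untruncatedModel Z V₀ α A) P (huslerReissCdf (factorLam Z P α A))) ∧
    HasStdf (factorModel Z Zs V₀ α c) P (fun x =>
      ∑ A : Finset (Fin d),
        huslerReissStdf (factorLam Z P α A) (fun i : A => x i / stdNormalCdf (-c i)) *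
          P.real {ω | (∀ i ∈ A, c i < Zs ω i) ∧ ∀ i ∉ A, Zs ω i < c i}) := by
  have hVZ : IndepFun V₀ Z P := hV₀indep.comp measurable_id measurable_fst
  exact ⟨fun A =>
    ⟨hasStdf_untruncatedModel hα hGauss.fst hZmean hZvar hV₀ hVZ A,
      hasEVLimit_untruncatedModel hα hGauss.fst hZmean hZvar hV₀ hVZ A⟩,
    hasStdf_factorModel hα hGauss hZmean hZsmean hZvar hZsvar hV₀ hV₀indep hindep⟩
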